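/- Let $k$ be a commutative ring, $\mathcal U$ a small category, and $\mathcal A$ a prestack of small $k$-linear categories on $\mathcal U$, that is: a small $k$-linear category $\mathcal A(U)$ for each object $U$, a $k$-linear functor $u^*\colon \mathcal A(U)\to\mathcal A(V)$ for each $u\colon V\to U$, and natural isomorphisms $c^{u,v}\colon v^*u^*\to(uv)^*$ (for $v\colon W\to V$, $u\colon V\to U$) and $z^U\colon 1_{\mathcal A(U)}\to (1_U)^*$ satisfying $$c^{u,vw}(c^{v,w}\circ u^*)=c^{uv,w}(w^*\circ c^{u,v}),\qquad c^{u,1_V}(z^V\circ u^*)=1,\qquad c^{1_U,u}(u^*\circ z^U)=1 .$$ Let $\mathsf{Mod}(\mathcal A(U))$ be the category of $k$-linear functors $\mathcal A(U)^{\mathrm{op}}\to\mathsf{Mod}(k)$. For $u\colon V\to U$ let $-\otimes_u\mathcal A(V)\colon\mathsf{Mod}(\mathcal A(U))\to\mathsf{Mod}(\mathcal A(V))$ be the functor with $$(F\otimes_u\mathcal A(V))(B)=\Bigl(\bigoplus_{A\in\mathcal A(U)}F(A)\otimes_k\mathcal A(V)(B,u^*A)\Bigr)\Big/\bigl(F(a)(x)\otimes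 y\sim x\otimes u^*(a)y\bigr),$$ where $a\colon A\to A'$, $x\in F(A')$, $y\in\mathcal A(V)(B,u^*A)$. The categories $\mathsf{Mod}(\mathcal A(U))$ with these functors and the twists $x\otimes y\otimes b\mapsto x\otimes c^{u,v}v^*(y)b$ and $x\mapsto x\otimes z^U$ form a prestack $\mathsf{Mod}_{\mathcal A}$. Let $\mathsf{Qch}(\mathcal A)=\mathrm{Des}(\mathsf{Mod}_{\mathcal A})$ be its descent category. Its objects are families $M=(M_U)_U$ with $M_U\in\mathsf{Mod}(\mathcal A(U))$, together with isomorphisms $\varphi_u\colon M_U\otimes_u\mathcal A(V)\to M_V$ for all $u\colon V\to U$, such that for all $v\colon W\to V$ the composite of $\varphi_u\otimes_v\mathcal A(W)$ followed by $\varphi_v$ equals the composite of the twist $M_U\otimes_u\mathcal A(V)\otimes_v\mathcal A(W)\to M_U\otimes_{uv}\mathcal A(W)$ followed by $\varphi_{uv}$. Its morphisms are families of morphisms $M_U\to M'_U$ compatible with the $\varphi_u$, and they are added componentwise. **Theorem.** If $\mathcal A$ is geometric, i.e. all the functors $-\otimes_u\mathcal A(V)$ (for $u\colon V\to U$ in $\mathcal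 U$) are exact, then $\mathsf{Qch}(\mathcal A)$ is a Grothendieck abelian category, i.e. a cocomplete abelian category with exact filtered colimits and a set of generators. -/

import Mathlib

open CategoryTheory Opposite
open scoped DirectSum TensorProduct

universe w v u v' u'

noncomputable section

/-! ### Modules over small `k`-linear categories and tensor functors -/

section Modules

variable (k : Type w) [CommRing k]

/-- The condition on a functor `aᵒᵖ ⥤ Mod(k)` of being `k`-linear. -/
def isLinearModule (a : Type w) [Category.{w} a] [Preadditive a] [Linear k a] :
    ObjectProperty (aᵒᵖ ⥤ ModuleCat.{w} k) := fun F =>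
  (∀ {A A' : a} (f g : A ⟶ A'), F.map (f + g).op = F.map f.op + F.map g.op) ∧
  (∀ {A A' : a} (r : k) (f : A ⟶ A'), F.map (r • f).op = r • F.map f.op)

/-- `Mod(a)`: the category of (right) modules over the small `k`-linear category `a`, i.e. of
`k`-linear functors `aᵒᵖ ⥤ Mod(k)` and all natural transformations. -/
abbrev LinMod (a : Type w) [Category.{w} a] [Preadditive a] [Linear k a] :=
  (isLinearModule k a).FullSubcategory

end Modules

namespace LinMod

variable {k : Type w} [CommRing k]
variable {a : Type w} [Category.{w} a] [Preadditive a] [Linear k a]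
variable {b : Type w} [Category.{w} b] [Preadditive b] [Linear k b]
variable {d : Type w} [Category.{w} d] [Preadditive d] [Linear k d]

/-- The value `F(A)` of a module. -/
abbrev val (F : LinMod k a) (A : a) : ModuleCat.{w} k := F.obj.obj (op A)

/-- The action `F(f) : F(A') → F(A)` of a morphism `f : A ⟶ A'`. -/
def act (F : LinMod k a) {A A' : a} (f : A ⟶ A') : F.val A' →ₗ[k] F.val A :=
  (F.obj.map f.op).hom

lemma act_id (F : LinMod k a) (A : a) (x : F.val A) : F.act (𝟙 A) x = x := by
  simp [act]

lemma act_comp (F : LinMod k a) {A A' A'' : a} (f : A ⟶ A') (g : A' ⟶ A'') (x : F.val A'') :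
    F.act (f ≫ g) x = F.act f (F.act g x) := by
  simp [act]

lemma act_add (F : LinMod k a) {A A' : a} (f g : A ⟶ A') (x : F.val A') :
    F.act (f + g) x = F.act f x + F.act g x := by
  simp only [act, F.property.1]; rfl

lemma act_smul (F : LinMod k a) {A A' : a} (r : k) (f : A ⟶ A') (x : F.val A') :
    F.act (r • f) x = r • F.act f x := by
  simp only [act, F.property.2]; rfl

/-- The component `F(A) → F'(A)` of a morphism of modules. -/
def app {F F' : LinMod k a} (α : F ⟶ F') (A : a) : F.val A →ₗ[k] F'.val A :=
  (α.hom.app (op A)).hom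

lemma app_act {F F' : LinMod k a} (α : F ⟶ F') {A A' : a} (f : A ⟶ A') (x : F.val A') :
    app α A (F.act f x) = F'.act f (app α A' x) := by
  exact congrArg (fun g => g.hom x) (α.hom.naturality f.op)

lemma app_id (F : LinMod k a) (A : a) (x : F.val A) : app (𝟙 F) A x = x := rfl

lemma app_comp {F F' F'' : LinMod k a} (α : F ⟶ F') (β : F' ⟶ F'') (A : a) (x : F.val A) :
    app (α ≫ β) A x = app β A (app α A x) := rfl

lemma app_add {F F' : LinMod k a} (α β : F ⟶ F') (A : a) (x : F.val A) :
    app (α + β) A x = app α A x + app β A x := rfl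

lemma app_smul {F F' : LinMod k a} (r : k) (α : F ⟶ F') (A : a) (x : F.val A) :
    app (r • α) A x = r • app α A x := rfl

lemma hom_ext' {F F' : LinMod k a} {α β : F ⟶ F'}
    (h : ∀ A (x : F.val A), app α A x = app β A x) : α = β := by
  apply ObjectProperty.hom_ext
  ext A x
  exact h A.unop x

/-- A module from its values and the action of morphisms. -/
@[simps obj]
def mk (M : a → Type w) [∀ A, AddCommGroup (M A)] [∀ A, Module k (M A)]
    (act : ∀ {A A' : a} (_ : A ⟶ A'), M A' →ₗ[k] M A)
    (act_id : ∀ A (x : M A), act (𝟙 A) x = x)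
    (act_comp : ∀ {A A' A'' : a} (f : A ⟶ A') (g : A' ⟶ A'') (x : M A''),
      act (f ≫ g) x = act f (act g x))
    (act_add : ∀ {A A' : a} (f g : A ⟶ A') (x : M A'), act (f + g) x = act f x + act g x)
    (act_smul : ∀ {A A' : a} (r : k) (f : A ⟶ A') (x : M A'), act (r • f) x = r • act f x) :
    LinMod k a where
  obj :=
    { obj := fun A => ModuleCat.of k (M A.unop)
      map := fun f => ModuleCat.ofHom (act f.unop)
      map_id := fun A => by ext x; exact act_id _ x
      map_comp := fun f g => by ext x; exact act_comp _ _ x }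
  property := ⟨fun f g => by ext x; exact act_add f g x, fun r f => by ext x; exact act_smul r f x⟩

/-- A morphism of modules from its components. -/
def homMk {F F' : LinMod k a} (t : ∀ A, F.val A →ₗ[k] F'.val A)
    (nat : ∀ {A A' : a} (f : A ⟶ A') (x : F.val A'), t A (F.act f x) = F'.act f (t A' x)) :
    F ⟶ F' :=
  ObjectProperty.homMk
    { app := fun A => ModuleCat.ofHom (t A.unop)
      naturality := fun A A' f => by ext x; exact nat f.unop x }

lemma app_homMk {F F' : LinMod k a} (t : ∀ A, F.val A →ₗ[k] F'.val A)
    (nat : ∀ {A A' : a} (f : A ⟶ A') (x : F.val A'), t A (F.act f x) = F'.act f (t A' x))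
    (A : a) (x : F.val A) : app (homMk t nat) A x = t A x := rfl

/-! #### The tensor product `F ⊗_G b` along a functor `G : a ⥤ b` -/

open Classical in
/-- The submodule of `⨁_A F(A) ⊗ₖ b(B, G A)` generated by the elements
`F(f)(x) ⊗ y - x ⊗ G(f) y` for `f : A ⟶ A'`, `x ∈ F(A')`, `y ∈ b(B, G A)`. -/
def tensorRel (G : a ⥤ b) (F : LinMod k a) (B : b) :
    Submodule k (⨁ A : a, F.val A ⊗[k] (B ⟶ G.obj A)) :=
  Submodule.span k
    { z | ∃ (A A' : a) (f : A ⟶ A') (x : F.val A') (y : B ⟶ G.obj A),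
      z = DirectSum.lof k a (fun A => F.val A ⊗[k] (B ⟶ G.obj A)) A (F.act f x ⊗ₜ[k] y) -
        DirectSum.lof k a (fun A => F.val A ⊗[k] (B ⟶ G.obj A)) A' (x ⊗ₜ[k] (y ≫ G.map f)) }

/-- `(F ⊗_G b)(B) = ⨁_A F(A) ⊗ₖ b(B, G A) / ∼`. -/
def TensorVal (G : a ⥤ b) (F : LinMod k a) (B : b) : Type w :=
  (⨁ A : a, F.val A ⊗[k] (B ⟶ G.obj A)) ⧸ tensorRel G F B

namespace TensorVal

instance (G : a ⥤ b) (F : LinMod k a) (B : b) : AddCommGroup (TensorVal G F B) :=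
  inferInstanceAs (AddCommGroup (_ ⧸ tensorRel G F B))

instance (G : a ⥤ b) (F : LinMod k a) (B : b) : Module k (TensorVal G F B) :=
  inferInstanceAs (Module k (_ ⧸ tensorRel G F B))

variable {G : a ⥤ b} {F : LinMod k a} {B : b}

open Classical in
/-- The class of `x ⊗ y`, as a bilinear map in `x ∈ F(A)` and `y ∈ b(B, G A)`. -/
def tmul (G : a ⥤ b) (F : LinMod k a) (B : b) (A : a) :
    F.val A →ₗ[k] (B ⟶ G.obj A) →ₗ[k] TensorVal G F B :=
  (TensorProduct.mk k (F.val A) (B ⟶ G.obj A)).compr₂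
    ((tensorRel G F B).mkQ ∘ₗ
      DirectSum.lof k a (fun A => F.val A ⊗[k] (B ⟶ G.obj A)) A)

lemma tmul_act {A A' : a} (f : A ⟶ A') (x : F.val A') (y : B ⟶ G.obj A) :
    tmul G F B A (F.act f x) y = tmul G F B A' x (y ≫ G.map f) :=
  (Submodule.Quotient.eq _).2 (Submodule.subset_span ⟨A, A', f, x, y, rfl⟩)

lemma linearMap_ext {M : Type*} [AddCommGroup M] [Module k M] {s t : TensorVal G F B →ₗ[k] M}
    (h : ∀ A x y, s (tmul G F B A x y) = t (tmul G F B A x y)) : s = t := by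
  classical
  refine Submodule.linearMap_qext _ (DirectSum.linearMap_ext k fun A => ?_)
  exact TensorProduct.ext' fun x y => h A x y

open Classical in
/-- The linear map out of `(F ⊗_G b)(B)` given by a compatible family of bilinear maps. -/
def desc {M : Type*} [AddCommGroup M] [Module k M]
    (t : ∀ A, F.val A →ₗ[k] (B ⟶ G.obj A) →ₗ[k] M)
    (ht : ∀ (A A' : a) (f : A ⟶ A') (x : F.val A') (y : B ⟶ G.obj A),
      t A (F.act f x) y = t A' x (y ≫ G.map f)) :
    TensorVal G F B →ₗ[k] M :=
  (tensorRel G F B).liftQ (DirectSum.toModule k a M fun A => TensorProduct.lift (t A)) (by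
    refine Submodule.span_le.2 ?_
    rintro _ ⟨A, A', f, x, y, rfl⟩
    simp [DirectSum.toModule_lof, ht])

lemma desc_tmul {M : Type*} [AddCommGroup M] [Module k M]
    (t : ∀ A, F.val A →ₗ[k] (B ⟶ G.obj A) →ₗ[k] M)
    (ht : ∀ (A A' : a) (f : A ⟶ A') (x : F.val A') (y : B ⟶ G.obj A),
      t A (F.act f x) y = t A' x (y ≫ G.map f)) (A : a) (x : F.val A) (y : B ⟶ G.obj A) :
    desc t ht (tmul G F B A x y) = t A x y := by
  classical
  change DirectSum.toModule k a M (fun A => TensorProduct.lift (t A))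
    (DirectSum.lof k a (fun A => F.val A ⊗[k] (B ⟶ G.obj A)) A (x ⊗ₜ[k] y)) = _
  simp [DirectSum.toModule_lof]

end TensorVal

open TensorVal

/-- The action of `g : B ⟶ B'` on `F ⊗_G b`, sending `x ⊗ y` to `x ⊗ (y ∘ g)`. -/
def tensorAct (G : a ⥤ b) (F : LinMod k a) {B B' : b} (g : B ⟶ B') :
    TensorVal G F B' →ₗ[k] TensorVal G F B :=
  desc (fun A => (tmul G F B A).compl₂ (Linear.leftComp k (G.obj A) g))
    (fun _ _ f x y => by simp [tmul_act])

lemma tensorAct_tmul (G : a ⥤ b) (F : LinMod k a) {B B' : b} (g : B ⟶ B') {A : a} (x : F.val A)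
    (y : B' ⟶ G.obj A) : tensorAct G F g (tmul G F B' A x y) = tmul G F B A x (g ≫ y) :=
  desc_tmul _ _ A x y

/-- The module `F ⊗_G b`. -/
def tensorObj (G : a ⥤ b) (F : LinMod k a) : LinMod k b :=
  LinMod.mk (TensorVal G F)
    (tensorAct G F)
    (fun B x => by
      refine LinearMap.congr_fun (g := LinearMap.id) (linearMap_ext fun A x y => ?_) x
      simp [tensorAct_tmul])
    (fun {B B' B''} g h x => by
      refine LinearMap.congr_fun (g := tensorAct G F g ∘ₗ tensorAct G F h)
        (linearMap_ext fun A x y => ?_) x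
      simp [tensorAct_tmul])
    (fun {B B'} g h x => by
      refine LinearMap.congr_fun (g := tensorAct G F g + tensorAct G F h)
        (linearMap_ext fun A x y => ?_) x
      simp [tensorAct_tmul])
    (fun {B B'} r g x => by
      refine LinearMap.congr_fun (g := r • tensorAct G F g) (linearMap_ext fun A x y => ?_) x
      simp [tensorAct_tmul])

/-- The class of `x ⊗ y` in `(F ⊗_G b)(B)`, as a bilinear map. -/
def tmLin (G : a ⥤ b) (F : LinMod k a) (B : b) (A : a) :
    F.val A →ₗ[k] (B ⟶ G.obj A) →ₗ[k] (tensorObj G F).val B :=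
  tmul G F B A

/-- The class of `x ⊗ y` in `(F ⊗_G b)(B)`. -/
def tm (G : a ⥤ b) (F : LinMod k a) {B : b} {A : a} (x : F.val A) (y : B ⟶ G.obj A) :
    (tensorObj G F).val B :=
  tmLin G F B A x y

@[simp]
lemma tmLin_apply (G : a ⥤ b) (F : LinMod k a) {B : b} {A : a} (x : F.val A) (y : B ⟶ G.obj A) :
    tmLin G F B A x y = tm G F x y := rfl

@[simp]
lemma act_tm (G : a ⥤ b) (F : LinMod k a) {B B' : b} {A : a} (g : B ⟶ B') (x : F.val A)
    (y : B' ⟶ G.obj A) : (tensorObj G F).act g (tm G F x y) = tm G F x (g ≫ y) :=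
  tensorAct_tmul G F g x y

lemma tm_act (G : a ⥤ b) (F : LinMod k a) {B : b} {A A' : a} (f : A ⟶ A') (x : F.val A')
    (y : B ⟶ G.obj A) : tm G F (F.act f x) y = tm G F x (y ≫ G.map f) :=
  tmul_act f x y

lemma tensorObj_ext {G : a ⥤ b} {F : LinMod k a} {B : b} {M : Type*} [AddCommGroup M] [Module k M]
    {s t : (tensorObj G F).val B →ₗ[k] M}
    (h : ∀ (A : a) (x : F.val A) (y : B ⟶ G.obj A), s (tm G F x y) = t (tm G F x y)) : s = t :=
  linearMap_ext (G := G) (F := F) (B := B) h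

lemma tensorObj_hom_ext {G : a ⥤ b} {F : LinMod k a} {N : LinMod k b} {α β : tensorObj G F ⟶ N}
    (h : ∀ (B : b) (A : a) (x : F.val A) (y : B ⟶ G.obj A),
      app α B (tm G F x y) = app β B (tm G F x y)) : α = β :=
  hom_ext' fun B x => LinearMap.congr_fun (f := app α B) (g := app β B)
    (tensorObj_ext fun A x y => h B A x y) x

/-- The linear map `(F ⊗_G b)(B) → M` given by compatible bilinear maps. -/
def descVal {G : a ⥤ b} {F : LinMod k a} {B : b} {M : Type w} [AddCommGroup M] [Module k M]
    (t : ∀ A, F.val A →ₗ[k] (B ⟶ G.obj A) →ₗ[k] M)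
    (ht : ∀ (A A' : a) (f : A ⟶ A') (x : F.val A') (y : B ⟶ G.obj A),
      t A (F.act f x) y = t A' x (y ≫ G.map f)) : (tensorObj G F).val B →ₗ[k] M :=
  desc t ht

@[simp]
lemma descVal_tm {G : a ⥤ b} {F : LinMod k a} {B : b} {M : Type w} [AddCommGroup M] [Module k M]
    (t : ∀ A, F.val A →ₗ[k] (B ⟶ G.obj A) →ₗ[k] M)
    (ht : ∀ (A A' : a) (f : A ⟶ A') (x : F.val A') (y : B ⟶ G.obj A),
      t A (F.act f x) y = t A' x (y ≫ G.map f)) {A : a} (x : F.val A) (y : B ⟶ G.obj A) :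
    descVal t ht (tm G F x y) = t A x y :=
  desc_tmul t ht A x y

/-- The morphism out of `F ⊗_G b` given by compatible bilinear maps natural in `B`. -/
def descHom {G : a ⥤ b} {F : LinMod k a} {N : LinMod k b}
    (t : ∀ B A, F.val A →ₗ[k] (B ⟶ G.obj A) →ₗ[k] N.val B)
    (ht : ∀ (B) (A A' : a) (f : A ⟶ A') (x : F.val A') (y : B ⟶ G.obj A),
      t B A (F.act f x) y = t B A' x (y ≫ G.map f))
    (nat : ∀ (B B' : b) (g : B ⟶ B') (A : a) (x : F.val A) (y : B' ⟶ G.obj A),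
      t B A x (g ≫ y) = N.act g (t B' A x y)) : tensorObj G F ⟶ N :=
  homMk (fun B => descVal (t B) (ht B)) (fun {B B'} g x => by
    refine LinearMap.congr_fun (f := descVal (t B) (ht B) ∘ₗ (tensorObj G F).act g)
      (g := N.act g ∘ₗ descVal (t B') (ht B')) (tensorObj_ext fun A x y => ?_) x
    simp [nat])

@[simp]
lemma app_descHom {G : a ⥤ b} {F : LinMod k a} {N : LinMod k b}
    (t : ∀ B A, F.val A →ₗ[k] (B ⟶ G.obj A) →ₗ[k] N.val B)
    (ht : ∀ (B) (A A' : a) (f : A ⟶ A') (x : F.val A') (y : B ⟶ G.obj A),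
      t B A (F.act f x) y = t B A' x (y ≫ G.map f))
    (nat : ∀ (B B' : b) (g : B ⟶ B') (A : a) (x : F.val A) (y : B' ⟶ G.obj A),
      t B A x (g ≫ y) = N.act g (t B' A x y)) {B : b} {A : a} (x : F.val A) (y : B ⟶ G.obj A) :
    app (descHom t ht nat) B (tm G F x y) = t B A x y :=
  descVal_tm (t B) (ht B) x y

/-- The morphism `F ⊗_G b ⟶ F' ⊗_G b` induced by `α : F ⟶ F'`. -/
def tensorMap (G : a ⥤ b) {F F' : LinMod k a} (α : F ⟶ F') : tensorObj G F ⟶ tensorObj G F' :=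
  descHom (fun B A => (tmLin G F' B A).comp (app α A))
    (fun B A A' f x y => by simp [app_act, tm_act]) (fun _ _ g A x y => by simp)

@[simp]
lemma tensorMap_tm (G : a ⥤ b) {F F' : LinMod k a} (α : F ⟶ F') {B : b} {A : a} (x : F.val A)
    (y : B ⟶ G.obj A) : app (tensorMap G α) B (tm G F x y) = tm G F' (app α A x) y :=
  app_descHom _ _ _ x y

/-- The tensor functor `- ⊗_G b : Mod(a) ⥤ Mod(b)`. -/
def tensor (G : a ⥤ b) : LinMod k a ⥤ LinMod k b where
  obj F := tensorObj G F
  map α := tensorMap G α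
  map_id F := tensorObj_hom_ext fun B A x y => by simp [app_id]
  map_comp α β := tensorObj_hom_ext fun B A x y => by simp [app_comp]

instance (G : a ⥤ b) : (tensor (k := k) G).Additive where
  map_add {F F' α β} := tensorObj_hom_ext fun B A x y => by
    change app (tensorMap G (α + β)) B _ = app (tensorMap G α + tensorMap G β) B _
    rw [app_add, tensorMap_tm, tensorMap_tm, tensorMap_tm, app_add, ← tmLin_apply, map_add]; rfl

instance (G : a ⥤ b) : (tensor (k := k) G).Linear k where
  map_smul {F F'} α r := tensorObj_hom_ext fun B A x y => by
    change app (tensorMap G (r • α)) B _ = app (r • tensorMap G α) B _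
    rw [app_smul, tensorMap_tm, tensorMap_tm, app_smul, ← tmLin_apply, map_smul]; rfl

/-- An isomorphism `ζ : 1 ≅ G` induces `F ≅ F ⊗_G a`, `x ↦ x ⊗ ζ`. -/
def tensorUnitApp {G : a ⥤ a} (ζ : 𝟭 a ≅ G) (F : LinMod k a) : F ≅ tensorObj G F where
  hom := homMk (fun A => (tmLin G F A A).flip (ζ.hom.app A)) (fun {A A'} f x => by
    simp only [LinearMap.flip_apply, tmLin_apply, act_tm, tm_act]
    exact congrArg (tm G F x) (ζ.hom.naturality f).symm)
  inv := descHom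
    (fun B A => LinearMap.mk₂ k (fun x y => F.act (y ≫ ζ.inv.app A) x)
      (fun _ _ _ => map_add _ _ _) (fun _ _ _ => map_smul _ _ _)
      (fun x y y' => by rw [Preadditive.add_comp, act_add])
      (fun r x y => by rw [Linear.smul_comp, act_smul]))
    (fun B A A' f x y => by
      have := ζ.inv.naturality f
      simp only [Functor.id_map] at this
      simp only [LinearMap.mk₂_apply]
      rw [← act_comp, Category.assoc, Category.assoc, this])
    (fun _ _ g A x y => by
      simp only [LinearMap.mk₂_apply, act_comp])
  hom_inv_id := hom_ext' fun A x => by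
    rw [app_comp, app_homMk, LinearMap.flip_apply, tmLin_apply]
    refine (app_descHom _ _ _ x (ζ.hom.app A)).trans ?_
    rw [LinearMap.mk₂_apply, Iso.hom_inv_id_app]
    exact act_id F A x
  inv_hom_id := tensorObj_hom_ext fun B A x y => by
    rw [app_comp, app_descHom, LinearMap.mk₂_apply, app_homMk, LinearMap.flip_apply,
      tmLin_apply, tm_act, app_id]
    have := ζ.hom.naturality (y ≫ ζ.inv.app A)
    simp only [Functor.id_map] at this
    rw [← this]
    simp

lemma tensorUnitApp_hom {G : a ⥤ a} (ζ : 𝟭 a ≅ G) (F : LinMod k a) {A : a} (x : F.val A) :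
    app (tensorUnitApp ζ F).hom A x = tm G F x (ζ.hom.app A) := rfl

/-- The natural isomorphism `1 ≅ - ⊗_G a` induced by `ζ : 1 ≅ G`. -/
def tensorUnit {G : a ⥤ a} (ζ : 𝟭 a ≅ G) : 𝟭 (LinMod k a) ≅ tensor G :=
  NatIso.ofComponents (tensorUnitApp ζ) (fun α => hom_ext' fun A x =>
    (tensorMap_tm G α x (ζ.hom.app A)).symm)

lemma tensorComp_ext {G : a ⥤ b} {H : b ⥤ d} {F : LinMod k a} {N : LinMod k d}
    {s t : tensorObj H (tensorObj G F) ⟶ N}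
    (h : ∀ (C : d) (B : b) (A : a) (x : F.val A) (y : B ⟶ G.obj A) (z : C ⟶ H.obj B),
      app s C (tm H _ (tm G F x y) z) = app t C (tm H _ (tm G F x y) z)) : s = t :=
  tensorObj_hom_ext fun C B m z => LinearMap.congr_fun
    (f := app s C ∘ₗ (tmLin H (tensorObj G F) C B).flip z)
    (g := app t C ∘ₗ (tmLin H (tensorObj G F) C B).flip z)
    (tensorObj_ext fun A x y => h C B A x y z) m

section Comp

variable {G : a ⥤ b} {H : b ⥤ d} {K : a ⥤ d}

/-- The morphism `F ⊗_K d ⟶ (F ⊗_G b) ⊗_H d`, `x ⊗ w ↦ x ⊗ 1 ⊗ (β ∘ w)`. -/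
def tensorCompInv (β : K ⟶ G ⋙ H) (F : LinMod k a) :
    tensorObj K F ⟶ tensorObj H (tensorObj G F) :=
  descHom (fun C A => (tmLin H (tensorObj G F) C (G.obj A)).compl₁₂
      ((tmLin G F (G.obj A) A).flip (𝟙 _)) (Linear.rightComp k C (β.app A)))
    (fun C A A' f x y => by
      have h₁ := tm_act H (tensorObj G F) (G.map f) (tm G F x (𝟙 (G.obj A'))) (y ≫ β.app A)
      have h₂ := β.naturality f
      simp only [Functor.comp_map] at h₂
      simp only [act_tm, Category.comp_id, Category.assoc, ← h₂] at h₁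
      simp [tm_act, h₁])
    (fun _ _ g A x y => by simp)

@[simp]
lemma tensorCompInv_tm (β : K ⟶ G ⋙ H) (F : LinMod k a) {C : d} {A : a} (x : F.val A)
    (y : C ⟶ K.obj A) :
    app (tensorCompInv β F) C (tm K F x y) =
      tm H (tensorObj G F) (tm G F x (𝟙 (G.obj A))) (y ≫ β.app A) := by
  rw [tensorCompInv, app_descHom]
  rfl

variable [H.Additive] [H.Linear k]

/-- The map `(F ⊗_G b)(B) × d(C, H B) → (F ⊗_K d)(C)`, `(x ⊗ y, z) ↦ x ⊗ (α ∘ H(y) ∘ z)`. -/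
def tensorCompAux (α : G ⋙ H ⟶ K) (F : LinMod k a) (C : d) (B : b) :
    (tensorObj G F).val B →ₗ[k] (C ⟶ H.obj B) →ₗ[k] (tensorObj K F).val C :=
  descVal
    (fun A => LinearMap.mk₂ k
      (fun x y => tmLin K F C A x ∘ₗ Linear.rightComp k C (H.map y ≫ α.app A))
      (fun x x' y => by rw [map_add]; rfl)
      (fun r x y => by rw [map_smul]; rfl)
      (fun x y y' => by
        ext z
        simp only [Functor.map_add, Preadditive.add_comp, LinearMap.comp_apply,
          LinearMap.add_apply, Linear.rightComp_apply, Preadditive.comp_add, map_add])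
      (fun r x y => by
        ext z
        simp only [Functor.map_smul, Linear.smul_comp, LinearMap.comp_apply,
          LinearMap.smul_apply, Linear.rightComp_apply, Linear.comp_smul, map_smul]))
    (fun A A' f x y => by
      ext z
      have := α.naturality f
      simp only [Functor.comp_map] at this
      simp [tm_act, this])

@[simp]
lemma tensorCompAux_tm (α : G ⋙ H ⟶ K) (F : LinMod k a) {C : d} {B : b} {A : a} (x : F.val A)
    (y : B ⟶ G.obj A) (z : C ⟶ H.obj B) :
    tensorCompAux α F C B (tm G F x y) z = tm K F x (z ≫ H.map y ≫ α.app A) :=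
  LinearMap.congr_fun (descVal_tm _ _ x y) z

lemma tensorCompAux_act (α : G ⋙ H ⟶ K) (F : LinMod k a) (C : d) (B B' : b) (f : B ⟶ B')
    (m : (tensorObj G F).val B') (z : C ⟶ H.obj B) :
    tensorCompAux α F C B ((tensorObj G F).act f m) z =
      tensorCompAux α F C B' m (z ≫ H.map f) :=
  LinearMap.congr_fun
    (f := (tensorCompAux α F C B).flip z ∘ₗ (tensorObj G F).act f)
    (g := (tensorCompAux α F C B').flip (z ≫ H.map f))
    (tensorObj_ext fun A x y => by simp) m

lemma tensorCompAux_comp (α : G ⋙ H ⟶ K) (F : LinMod k a) (C C' : d) (g : C ⟶ C') (B : b)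
    (m : (tensorObj G F).val B) (z : C' ⟶ H.obj B) :
    tensorCompAux α F C B m (g ≫ z) = (tensorObj K F).act g (tensorCompAux α F C' B m z) :=
  LinearMap.congr_fun
    (f := (tensorCompAux α F C B).flip (g ≫ z))
    (g := (tensorObj K F).act g ∘ₗ (tensorCompAux α F C' B).flip z)
    (tensorObj_ext fun A x y => by simp) m

/-- The morphism `(F ⊗_G b) ⊗_H d ⟶ F ⊗_K d`, `x ⊗ y ⊗ z ↦ x ⊗ (α ∘ H(y) ∘ z)`. -/
def tensorCompHom (α : G ⋙ H ⟶ K) (F : LinMod k a) :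
    tensorObj H (tensorObj G F) ⟶ tensorObj K F :=
  descHom (tensorCompAux α F) (tensorCompAux_act α F) (tensorCompAux_comp α F)

@[simp]
lemma tensorCompHom_tm (α : G ⋙ H ⟶ K) (F : LinMod k a) {C : d} {B : b} {A : a} (x : F.val A)
    (y : B ⟶ G.obj A) (z : C ⟶ H.obj B) :
    app (tensorCompHom α F) C (tm H _ (tm G F x y) z) = tm K F x (z ≫ H.map y ≫ α.app A) := by
  rw [tensorCompHom, app_descHom, tensorCompAux_tm]

/-- An isomorphism `α : H G ≅ K` induces `(F ⊗_G b) ⊗_H d ≅ F ⊗_K d`. -/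
def tensorCompApp (α : G ⋙ H ≅ K) (F : LinMod k a) :
    tensorObj H (tensorObj G F) ≅ tensorObj K F where
  hom := tensorCompHom α.hom F
  inv := tensorCompInv α.inv F
  hom_inv_id := tensorComp_ext fun C B A x y z => by
    have h₁ := tm_act H (tensorObj G F) y (tm G F x (𝟙 (G.obj A))) z
    simp only [act_tm, Category.comp_id] at h₁
    simp [app_comp, app_id, h₁]
  inv_hom_id := tensorObj_hom_ext fun C A x y => by
    simp [app_comp, app_id]

/-- The natural isomorphism `(- ⊗_G b) ⊗_H d ≅ - ⊗_K d` induced by `α : H G ≅ K`. -/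
def tensorComp (α : G ⋙ H ≅ K) : tensor (k := k) G ⋙ tensor H ≅ tensor K :=
  NatIso.ofComponents (tensorCompApp α) (fun {F F'} β => tensorComp_ext fun C B A x y z => by
    change app (tensorMap H (tensorMap G β) ≫ tensorCompHom α.hom F') C _ =
      app (tensorCompHom α.hom F ≫ tensorMap K β) C _
    simp [app_comp])

end Comp

lemma eqToHom_tm {G G' : a ⥤ b} (h : G = G') (F : LinMod k a)
    (e : tensorObj G F = tensorObj G' F) {B : b} {A : a} (x : F.val A) (y : B ⟶ G.obj A) :
    app (eqToHom e) B (tm G F x y) = tm G' F x (y ≫ eqToHom (by rw [h])) := by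
  subst h
  rw [eqToHom_refl, eqToHom_refl, Category.comp_id]
  rfl

lemma tensorComp_assoc {e : Type w} [Category.{w} e] [Preadditive e] [Linear k e]
    {G₁ : a ⥤ b} {G₂ : b ⥤ d} {G₃ : d ⥤ e} [G₂.Additive] [G₂.Linear k] [G₃.Additive]
    [G₃.Linear k] {K : a ⥤ d} {L : b ⥤ e} [L.Additive] [L.Linear k] {M M' : a ⥤ e}
    (α : G₁ ⋙ G₂ ⟶ K) (β : G₂ ⋙ G₃ ⟶ L) (γ : G₁ ⋙ L ⟶ M) (δ : K ⋙ G₃ ⟶ M') (h : M = M')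
    (H : ∀ A, β.app (G₁.obj A) ≫ γ.app A ≫ eqToHom (by rw [h]) =
      G₃.map (α.app A) ≫ δ.app A) (F : LinMod k a) (e : tensorObj M F = tensorObj M' F) :
    tensorCompHom β (tensorObj G₁ F) ≫ tensorCompHom γ F ≫ eqToHom e =
      tensorMap G₃ (tensorCompHom α F) ≫ tensorCompHom δ F :=
  tensorObj_hom_ext fun D C m z => LinearMap.congr_fun
    (f := app (tensorCompHom β (tensorObj G₁ F) ≫ tensorCompHom γ F ≫ eqToHom e) D ∘ₗ
      (tmLin G₃ _ D C).flip z)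
    (g := app (tensorMap G₃ (tensorCompHom α F) ≫ tensorCompHom δ F) D ∘ₗ
      (tmLin G₃ _ D C).flip z)
    (tensorObj_ext fun B n y => LinearMap.congr_fun
      (f := (app (tensorCompHom β (tensorObj G₁ F) ≫ tensorCompHom γ F ≫ eqToHom e) D ∘ₗ
        (tmLin G₃ _ D C).flip z) ∘ₗ (tmLin G₂ _ C B).flip y)
      (g := (app (tensorMap G₃ (tensorCompHom α F) ≫ tensorCompHom δ F) D ∘ₗ
        (tmLin G₃ _ D C).flip z) ∘ₗ (tmLin G₂ _ C B).flip y)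
      (tensorObj_ext fun A x y' => by
        have h₁ := β.naturality y'
        simp only [Functor.comp_map] at h₁
        simp only [LinearMap.comp_apply, LinearMap.flip_apply, tmLin_apply, app_comp,
          tensorCompHom_tm, tensorMap_tm, eqToHom_tm h, Category.assoc, Functor.map_comp, ← H]
        rw [← reassoc_of% h₁]) n) m

lemma tensorUnit_left {G M : a ⥤ b} {G' : b ⥤ b} [G'.Additive] [G'.Linear k] (ζ : 𝟭 b ≅ G')
    (α : G ⋙ G' ⟶ M) (h : G = M)
    (H : ∀ A, ζ.hom.app (G.obj A) ≫ α.app A = eqToHom (by rw [h]; rfl)) (F : LinMod k a)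
    (e : tensorObj G F = tensorObj M F) :
    (tensorUnitApp ζ (tensorObj G F)).hom ≫ tensorCompHom α F = eqToHom e :=
  tensorObj_hom_ext fun B A x y => by
    rw [app_comp, tensorUnitApp_hom, tensorCompHom_tm, eqToHom_tm h]
    have := ζ.hom.naturality y
    simp only [Functor.id_map] at this
    rw [← reassoc_of% this, H]

lemma tensorUnit_right {G M : a ⥤ b} {G' : a ⥤ a} [G.Additive] [G.Linear k] (ζ : 𝟭 a ≅ G')
    (α : G' ⋙ G ⟶ M) (h : G = M)
    (H : ∀ A, G.map (ζ.hom.app A) ≫ α.app A = eqToHom (by rw [h]; rfl)) (F : LinMod k a)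
    (e : tensorObj G F = tensorObj M F) :
    tensorMap G (tensorUnitApp ζ F).hom ≫ tensorCompHom α F = eqToHom e :=
  tensorObj_hom_ext fun B A x y => by
    rw [app_comp, tensorMap_tm, tensorUnitApp_hom, tensorCompHom_tm, eqToHom_tm h, H]

end LinMod

/-! ### Prestacks and descent data -/

/-- A prestack on `𝒰`: a pseudofunctor on `𝒰` with values in `k`-linear categories. -/
structure Prestack (k : Type w) [CommRing k] (𝒰 : Type u) [Category.{v} 𝒰] where
  /-- the `k`-linear categories `𝒜(U)` -/
  obj : 𝒰 → Type u'
  [category : ∀ U, Category.{v'} (obj U)]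
  [preadditive : ∀ U, Preadditive (obj U)]
  [linear : ∀ U, Linear k (obj U)]
  /-- the `k`-linear restriction functors `u^*` -/
  res : ∀ {V U : 𝒰}, (V ⟶ U) → (obj U ⥤ obj V)
  [res_additive : ∀ {V U : 𝒰} (u : V ⟶ U), (res u).Additive]
  [res_linear : ∀ {V U : 𝒰} (u : V ⟶ U), (res u).Linear k]
  /-- the twist isomorphisms `c^{u,v} : v^* u^* ≅ (u v)^*` -/
  c : ∀ {W V U : 𝒰} (u : V ⟶ U) (v : W ⟶ V), res u ⋙ res v ≅ res (v ≫ u)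
  /-- the twist isomorphisms `z^U : 1 ≅ (1_U)^*` -/
  z : ∀ U : 𝒰, 𝟭 (obj U) ≅ res (𝟙 U)
  c_assoc : ∀ {T W V U : 𝒰} (u : V ⟶ U) (v : W ⟶ V) (x : T ⟶ W) (A : obj U),
    (c v x).hom.app ((res u).obj A) ≫ (c u (x ≫ v)).hom.app A ≫
        eqToHom (by rw [Category.assoc]) =
      (res x).map ((c u v).hom.app A) ≫ (c (v ≫ u) x).hom.app A
  z_left : ∀ {V U : 𝒰} (u : V ⟶ U) (A : obj U),
    (z V).hom.app ((res u).obj A) ≫ (c u (𝟙 V)).hom.app A = eqToHom (by simp)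
  z_right : ∀ {V U : 𝒰} (u : V ⟶ U) (A : obj U),
    (res u).map ((z U).hom.app A) ≫ (c (𝟙 U) u).hom.app A = eqToHom (by simp)

namespace Prestack

attribute [instance] category preadditive linear res_additive res_linear

variable {k : Type w} [CommRing k] {𝒰 : Type u} [Category.{v} 𝒰]

/-- A pre-descent datum in a prestack. -/
structure PreDescentDatum (ℬ : Prestack.{w, v, u, v', u'} k 𝒰) where
  /-- the objects `B_U` -/
  obj : ∀ U, ℬ.obj U
  /-- the morphisms `φ_u : u^* B_U ⟶ B_V` -/
  φ : ∀ {V U : 𝒰} (u : V ⟶ U), (ℬ.res u).obj (obj U) ⟶ obj V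
  comp : ∀ {W V U : 𝒰} (u : V ⟶ U) (v : W ⟶ V),
    (ℬ.res v).map (φ u) ≫ φ v = (ℬ.c u v).hom.app (obj U) ≫ φ (v ≫ u)

namespace PreDescentDatum

variable {ℬ : Prestack.{w, v, u, v', u'} k 𝒰}

/-- A morphism of pre-descent data. -/
@[ext]
structure Hom (B B' : ℬ.PreDescentDatum) where
  /-- the morphisms `g_U : B_U ⟶ B'_U` -/
  app : ∀ U, B.obj U ⟶ B'.obj U
  comm : ∀ {V U : 𝒰} (u : V ⟶ U), (ℬ.res u).map (app U) ≫ B'.φ u = B.φ u ≫ app V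

/-- The category `PDes(ℬ)`. -/
instance : Category ℬ.PreDescentDatum where
  Hom := Hom
  id B := { app := fun _ => 𝟙 _, comm := fun u => by simp }
  comp f g :=
    { app := fun U => f.app U ≫ g.app U
      comm := fun u => by
        rw [Functor.map_comp, Category.assoc, g.comm, ← Category.assoc, f.comm, Category.assoc] }
  id_comp _ := Hom.ext (funext fun _ => Category.id_comp _)
  comp_id _ := Hom.ext (funext fun _ => Category.comp_id _)
  assoc _ _ _ := Hom.ext (funext fun _ => Category.assoc _ _ _)

variable {B B' : ℬ.PreDescentDatum}

instance : Zero (B ⟶ B') := ⟨{ app := fun _ => 0, comm := fun u => by simp }⟩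

instance : Add (B ⟶ B') :=
  ⟨fun f g => { app := fun U => Hom.app f U + Hom.app g U, comm := fun u => by simp [Hom.comm] }⟩

instance : Neg (B ⟶ B') :=
  ⟨fun f => { app := fun U => -Hom.app f U, comm := fun u => by simp [Hom.comm] }⟩

instance : Sub (B ⟶ B') :=
  ⟨fun f g => { app := fun U => Hom.app f U - Hom.app g U, comm := fun u => by simp [Hom.comm] }⟩

instance : SMul ℕ (B ⟶ B') :=
  ⟨fun n f => { app := fun U => n • Hom.app f U
                comm := fun u => by simp [Hom.comm] }⟩

instance : SMul ℤ (B ⟶ B') :=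
  ⟨fun n f => { app := fun U => n • Hom.app f U
                comm := fun u => by simp [Hom.comm] }⟩

instance : AddCommGroup (B ⟶ B') :=
  Function.Injective.addCommGroup (fun f : B ⟶ B' => (Hom.app f : ∀ U, B.obj U ⟶ B'.obj U))
    (fun _ _ h => Hom.ext h) rfl (fun _ _ => rfl) (fun _ => rfl) (fun _ _ => rfl)
    (fun _ _ => rfl) (fun _ _ => rfl)

/-- Morphisms of pre-descent data are added componentwise. -/
instance : Preadditive ℬ.PreDescentDatum where
  add_comp _ _ _ _ _ _ := Hom.ext (funext fun _ => Preadditive.add_comp _ _ _ _ _ _)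
  comp_add _ _ _ _ _ _ := Hom.ext (funext fun _ => Preadditive.comp_add _ _ _ _ _ _)

end PreDescentDatum

/-- A pre-descent datum is a descent datum if all `φ_u` are isomorphisms. -/
def isDescentDatum (ℬ : Prestack.{w, v, u, v', u'} k 𝒰) : ObjectProperty ℬ.PreDescentDatum :=
  fun B => ∀ {V U : 𝒰} (u : V ⟶ U), IsIso (B.φ u)

/-- The descent category `Des(ℬ)`, a full subcategory of `PDes(ℬ)`. -/
abbrev Des (ℬ : Prestack.{w, v, u, v', u'} k 𝒰) := ℬ.isDescentDatum.FullSubcategory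

/-- The additive structure on `Des(ℬ)`: morphisms are added componentwise. -/
abbrev desPreadditive (ℬ : Prestack.{w, v, u, v', u'} k 𝒰) : Preadditive ℬ.Des :=
  Preadditive.fullSubcategory ℬ.isDescentDatum

/-! ### Quasi-coherent modules -/

/-- The prestack `Mod_𝒜` of a prestack `𝒜` of small `k`-linear categories: its values are the
module categories `Mod(𝒜(U))`, its restriction functors the tensor functors `- ⊗_u 𝒜(V)`, and its
twists are `x ⊗ y ⊗ z ↦ x ⊗ (c^{u,v} ∘ v^*(y) ∘ z)` and `x ↦ x ⊗ z^U`. -/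
def modPrestack (𝒜 : Prestack.{w, v, u, w, w} k 𝒰) : Prestack.{w, v, u, w, w + 1} k 𝒰 where
  obj U := LinMod k (𝒜.obj U)
  res u := LinMod.tensor (𝒜.res u)
  c u v := LinMod.tensorComp (𝒜.c u v)
  z U := LinMod.tensorUnit (𝒜.z U)
  c_assoc u v x F := LinMod.tensorComp_assoc (𝒜.c u v).hom (𝒜.c v x).hom (𝒜.c u (x ≫ v)).hom
    (𝒜.c (v ≫ u) x).hom (by rw [Category.assoc]) (𝒜.c_assoc u v x) F
    (by rw [Category.assoc])
  z_left {V _} u F := LinMod.tensorUnit_left (𝒜.z V) (𝒜.c u (𝟙 V)).hom (by rw [Category.id_comp])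
    (𝒜.z_left u) F (by rw [Category.id_comp])
  z_right {_ U} u F := LinMod.tensorUnit_right (𝒜.z U) (𝒜.c (𝟙 U) u).hom
    (by rw [Category.comp_id]) (𝒜.z_right u) F (by rw [Category.comp_id])

/-- A prestack `𝒜` of small `k`-linear categories is geometric if all functors `- ⊗_u 𝒜(V)` are
exact. -/
def IsGeometric (𝒜 : Prestack.{w, v, u, w, w} k 𝒰) : Prop :=
  ∀ {V U : 𝒰} (u : V ⟶ U),
    exactFunctor (LinMod k (𝒜.obj U)) (LinMod k (𝒜.obj V)) (LinMod.tensor (𝒜.res u))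

/-- The category `Qch(𝒜) = Des(Mod_𝒜)` of (right) quasi-coherent modules. -/
abbrev Qch (𝒜 : Prestack.{w, v, u, w, w} k 𝒰) := 𝒜.modPrestack.Des

end Prestack

end

/-! Limits and colimits of descent data are computed componentwise as soon as the restriction
functors preserve them: the comparison maps between componentwise (co)limits are then isomorphisms,
and they inherit the cocycle identity from the diagram. For `modPrestack` the restrictions are
tensor functors. They are left adjoint to restriction of modules (`tensorRestrictAdj`), so colimits
always exist componentwise; finite limits do as well because geometricity makes the tensor functors
left exact.

Consequently the functor `qchValues`, recording all the `k`-modules M_U(A), is conservative and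
exact and commutes with colimits. Through it, the isomorphism of coimage with image
(`abelianOfConservativeExact`) and the exactness of filtered colimits are inherited from
`k`-modules.

For generators, take an element x of M_{U₀}(A₀) and close it under the action of morphisms, under m
↦ φ_u(m ⊗ y), and under passing from m in M_V(B) to chosen elements g of the modules M_U(A) for
which m is a combination of elements φ_u(g ⊗ y). The last closure makes N_U ⊗_u 𝒜(V) → N_V
surjective, and flatness makes it injective, so the span N of these elements is quasi-coherent
(`range_app_genAux`, `isIso_genφ`). The elements used are named by formal terms that depend on
neither M nor x. Each N_U(A) is thus a quotient of a free module on a fixed set, and up to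
isomorphism only a set of such N occurs (`exists_iso_genObj`, `exists_genIndex_hom`). The coproduct
of representatives is a separator. -/

noncomputable section

/-! ### Componentwise limits and colimits of descent data. -/

namespace Prestack

open Limits

variable {k : Type w} [CommRing k] {𝒰 : Type u} [Category.{v} 𝒰]
variable (ℬ : Prestack.{w, v, u, v', u'} k 𝒰)

/-- The functor `B ↦ B_U` on the descent category. -/
def desEval (U : 𝒰) : ℬ.Des ⥤ ℬ.obj U where
  obj B := B.obj.obj U
  map f := PreDescentDatum.Hom.app f.hom U

variable {ℬ} in
lemma Des.hom_ext {B B' : ℬ.Des} {f g : B ⟶ B'}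
    (h : ∀ U, (ℬ.desEval U).map f = (ℬ.desEval U).map g) : f = g :=
  ObjectProperty.hom_ext _ (PreDescentDatum.Hom.ext (funext h))

/-- The isomorphisms `φ_u : u^* B_U ≅ B_V` as a natural isomorphism. -/
def desEvalIso {V U : 𝒰} (u : V ⟶ U) : ℬ.desEval U ⋙ ℬ.res u ≅ ℬ.desEval V :=
  NatIso.ofComponents
    (fun B => @asIso _ _ _ _ (B.obj.φ u) (B.property u))
    (fun f => PreDescentDatum.Hom.comm f.hom u)

lemma desEvalIso_comp {W V U : 𝒰} (u : V ⟶ U) (v : W ⟶ V) (B : ℬ.Des) :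
    (ℬ.res v).map ((ℬ.desEvalIso u).hom.app B) ≫ (ℬ.desEvalIso v).hom.app B =
      (ℬ.c u v).hom.app ((ℬ.desEval U).obj B) ≫ (ℬ.desEvalIso (v ≫ u)).hom.app B :=
  B.obj.comp u v

variable {ℬ} in
/-- A descent datum from its components. -/
def Des.mk (obj : ∀ U, ℬ.obj U) (φ : ∀ {V U : 𝒰} (u : V ⟶ U), (ℬ.res u).obj (obj U) ≅ obj V)
    (comp : ∀ {W V U : 𝒰} (u : V ⟶ U) (v : W ⟶ V),
      (ℬ.res v).map (φ u).hom ≫ (φ v).hom = (ℬ.c u v).hom.app (obj U) ≫ (φ (v ≫ u)).hom) :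
    ℬ.Des where
  obj := { obj := obj, φ := fun u => (φ u).hom, comp := comp }
  property u := (φ u).isIso_hom

variable {ℬ} in
/-- A morphism of descent data from its components. -/
def Des.homMk {B B' : ℬ.Des} (t : ∀ U, (ℬ.desEval U).obj B ⟶ (ℬ.desEval U).obj B')
    (ht : ∀ {V U : 𝒰} (u : V ⟶ U), (ℬ.res u).map (t U) ≫ (ℬ.desEvalIso u).hom.app B' =
      (ℬ.desEvalIso u).hom.app B ≫ t V) : B ⟶ B' :=
  ObjectProperty.homMk (P := ℬ.isDescentDatum) (PreDescentDatum.Hom.mk t ht)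

lemma isIso_of_isIso_desEval {B B' : ℬ.Des} (f : B ⟶ B') [∀ U, IsIso ((ℬ.desEval U).map f)] :
    IsIso f := by
  refine ⟨Des.homMk (fun U => inv ((ℬ.desEval U).map f)) fun {V U} u => ?_,
    Des.hom_ext fun U => ?_, Des.hom_ext fun U => ?_⟩
  · rw [Functor.map_inv, IsIso.inv_comp_eq, ← Category.assoc, IsIso.eq_comp_inv]
    exact ((ℬ.desEvalIso u).hom.naturality f).symm
  · exact IsIso.hom_inv_id ((ℬ.desEval U).map f)
  · exact IsIso.inv_hom_id ((ℬ.desEval U).map f)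

section Limits

variable {ℬ} {J : Type*} [Category* J] (F : J ⥤ ℬ.Des)
  [∀ U, HasLimit (F ⋙ ℬ.desEval U)]
  [∀ {V U : 𝒰} (u : V ⟶ U), PreservesLimit (F ⋙ ℬ.desEval U) (ℬ.res u)]

/-- The comparison `u^* (lim B_U) ⟶ lim B_V` for a diagram of descent data. -/
def desLimitφ {V U : 𝒰} (u : V ⟶ U) :
    (ℬ.res u).obj (limit (F ⋙ ℬ.desEval U)) ≅ limit (F ⋙ ℬ.desEval V) :=
  IsLimit.conePointsIsoOfNatIso
    (isLimitOfPreserves (ℬ.res u) (limit.isLimit (F ⋙ ℬ.desEval U)))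
    (limit.isLimit _) (Functor.isoWhiskerLeft F (ℬ.desEvalIso u))

lemma desLimitφ_hom_π {V U : 𝒰} (u : V ⟶ U) (j : J) :
    (desLimitφ F u).hom ≫ limit.π (F ⋙ ℬ.desEval V) j =
      (ℬ.res u).map (limit.π (F ⋙ ℬ.desEval U) j) ≫ (ℬ.desEvalIso u).hom.app (F.obj j) :=
  IsLimit.conePointsIsoOfNatIso_hom_comp _
    (limit.isLimit (F ⋙ ℬ.desEval V)) (Functor.isoWhiskerLeft F (ℬ.desEvalIso u)) j

/-- Both sides map into a limit, so they may be compared after each projection; there the claim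
becomes the cocycle identity of `F.obj j`, by naturality of the twist. -/
lemma desLimitφ_comp {W V U : 𝒰} (u : V ⟶ U) (v : W ⟶ V) :
    (ℬ.res v).map (desLimitφ F u).hom ≫ (desLimitφ F v).hom =
      (ℬ.c u v).hom.app (limit (F ⋙ ℬ.desEval U)) ≫ (desLimitφ F (v ≫ u)).hom := by
  refine limit.hom_ext fun j => ?_
  have h₁ := congrArg (ℬ.res v).map (desLimitφ_hom_π F u j)
  have h₂ := (ℬ.c u v).hom.naturality (limit.π (F ⋙ ℬ.desEval U) j)
  rw [Functor.map_comp, Functor.map_comp] at h₁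
  rw [Category.assoc, Category.assoc, desLimitφ_hom_π, desLimitφ_hom_π, ← reassoc_of% h₂]
  refine (reassoc_of% h₁) _ |>.trans ?_
  exact congrArg (_ ≫ ·) (ℬ.desEvalIso_comp u v (F.obj j))

/-- The pointwise limit of a diagram of descent data. -/
def desLimit : ℬ.Des :=
  Des.mk (fun U => limit (F ⋙ ℬ.desEval U)) (desLimitφ F) (desLimitφ_comp F)

/-- The pointwise limit cone of a diagram of descent data. -/
def desLimitCone : Cone F where
  pt := desLimit F
  π :=
    { app j := Des.homMk (fun U => limit.π (F ⋙ ℬ.desEval U) j)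
        (fun u => (desLimitφ_hom_π F u j).symm)
      naturality _ _ f := Des.hom_ext fun U =>
        (Category.id_comp _).trans (limit.w (F ⋙ ℬ.desEval U) f).symm }

lemma desLimit_lift_comm (s : Cone F) {V U : 𝒰} (u : V ⟶ U) :
    (ℬ.res u).map (limit.lift (F ⋙ ℬ.desEval U) ((ℬ.desEval U).mapCone s)) ≫
        (desLimitφ F u).hom =
      (ℬ.desEvalIso u).hom.app s.pt ≫
        limit.lift (F ⋙ ℬ.desEval V) ((ℬ.desEval V).mapCone s) := by
  refine limit.hom_ext fun j => ?_
  rw [Category.assoc, Category.assoc, desLimitφ_hom_π, limit.lift_π, ← Functor.map_comp_assoc,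
    limit.lift_π]
  exact (ℬ.desEvalIso u).hom.naturality (s.π.app j)

/-- The pointwise limit cone is a limit cone. -/
def desLimitConeIsLimit : IsLimit (desLimitCone F) where
  lift s := Des.homMk (fun U => limit.lift (F ⋙ ℬ.desEval U) ((ℬ.desEval U).mapCone s))
    (desLimit_lift_comm F s)
  fac s j := Des.hom_ext fun U => limit.lift_π ((ℬ.desEval U).mapCone s) j
  uniq s _ h := Des.hom_ext fun U => limit.hom_ext fun j =>
    (congrArg (ℬ.desEval U).map (h j)).trans (limit.lift_π ((ℬ.desEval U).mapCone s) j).symm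

variable (ℬ J)

lemma hasLimitsOfShape_des [∀ U, HasLimitsOfShape J (ℬ.obj U)]
    [∀ {V U : 𝒰} (u : V ⟶ U), PreservesLimitsOfShape J (ℬ.res u)] :
    HasLimitsOfShape J ℬ.Des :=
  ⟨fun F => ⟨⟨_, desLimitConeIsLimit F⟩⟩⟩

lemma preservesLimitsOfShape_desEval [∀ U, HasLimitsOfShape J (ℬ.obj U)]
    [∀ {V U : 𝒰} (u : V ⟶ U), PreservesLimitsOfShape J (ℬ.res u)] (U : 𝒰) :
    PreservesLimitsOfShape J (ℬ.desEval U) :=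
  ⟨fun {F} => preservesLimit_of_preserves_limit_cone (desLimitConeIsLimit F)
    ((limit.isLimit (F ⋙ ℬ.desEval U)).ofIsoLimit (Cone.ext (Iso.refl _)
      (fun _ => (Category.id_comp _).symm)))⟩

end Limits

section Colimits

variable {ℬ} {J : Type*} [Category* J] (F : J ⥤ ℬ.Des)
  [∀ U, HasColimit (F ⋙ ℬ.desEval U)]
  [∀ {V U : 𝒰} (u : V ⟶ U), PreservesColimit (F ⋙ ℬ.desEval U) (ℬ.res u)]

/-- The comparison `u^* (colim B_U) ⟶ colim B_V` for a diagram of descent data. -/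
def desColimitφ {V U : 𝒰} (u : V ⟶ U) :
    (ℬ.res u).obj (colimit (F ⋙ ℬ.desEval U)) ≅ colimit (F ⋙ ℬ.desEval V) :=
  IsColimit.coconePointsIsoOfNatIso
    (isColimitOfPreserves (ℬ.res u) (colimit.isColimit (F ⋙ ℬ.desEval U)))
    (colimit.isColimit _) (Functor.isoWhiskerLeft F (ℬ.desEvalIso u))

lemma desColimit_ι_φ {V U : 𝒰} (u : V ⟶ U) (j : J) :
    (ℬ.res u).map (colimit.ι (F ⋙ ℬ.desEval U) j) ≫ (desColimitφ F u).hom =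
      (ℬ.desEvalIso u).hom.app (F.obj j) ≫ colimit.ι (F ⋙ ℬ.desEval V) j :=
  IsColimit.comp_coconePointsIsoOfNatIso_hom
    (isColimitOfPreserves (ℬ.res u) (colimit.isColimit (F ⋙ ℬ.desEval U)))
    _ (Functor.isoWhiskerLeft F (ℬ.desEvalIso u)) j

lemma desColimit_hom_ext {V U : 𝒰} (u : V ⟶ U) {X : ℬ.obj V}
    {f g : (ℬ.res u).obj (colimit (F ⋙ ℬ.desEval U)) ⟶ X}
    (h : ∀ j, (ℬ.res u).map (colimit.ι (F ⋙ ℬ.desEval U) j) ≫ f =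
      (ℬ.res u).map (colimit.ι (F ⋙ ℬ.desEval U) j) ≫ g) : f = g :=
  (isColimitOfPreserves (ℬ.res u) (colimit.isColimit (F ⋙ ℬ.desEval U))).hom_ext h

lemma desColimitφ_comp {W V U : 𝒰} (u : V ⟶ U) (v : W ⟶ V) :
    (ℬ.res v).map (desColimitφ F u).hom ≫ (desColimitφ F v).hom =
      (ℬ.c u v).hom.app (colimit (F ⋙ ℬ.desEval U)) ≫ (desColimitφ F (v ≫ u)).hom := by
  -- The source becomes the restriction of the colimit along the single morphism `v ≫ u`, so that
  -- `desColimit_hom_ext` applies.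
  rw [← cancel_epi ((ℬ.c u v).inv.app (colimit (F ⋙ ℬ.desEval U)))]
  refine desColimit_hom_ext F (v ≫ u) fun j => ?_
  have h₁ := congrArg (ℬ.res v).map (desColimit_ι_φ F u j)
  have h₂ := (ℬ.c u v).inv.naturality (colimit.ι (F ⋙ ℬ.desEval U) j)
  have h₃ := ℬ.desEvalIso_comp u v (F.obj j)
  rw [Functor.map_comp, Functor.map_comp] at h₁
  rw [Iso.inv_hom_id_app_assoc, desColimit_ι_φ, reassoc_of% h₂]
  refine (congrArg (_ ≫ ·) ((reassoc_of% h₁) _)).trans ?_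
  rw [desColimit_ι_φ]
  refine (congrArg (_ ≫ ·) ((reassoc_of% h₃) _)).trans ?_
  exact Iso.inv_hom_id_app_assoc (ℬ.c u v) _ _

/-- The pointwise colimit of a diagram of descent data. -/
def desColimit : ℬ.Des :=
  Des.mk (fun U => colimit (F ⋙ ℬ.desEval U)) (desColimitφ F) (desColimitφ_comp F)

/-- The pointwise colimit cocone of a diagram of descent data. -/
def desColimitCocone : Cocone F where
  pt := desColimit F
  ι :=
    { app j := Des.homMk (fun U => colimit.ι (F ⋙ ℬ.desEval U) j)
        (fun u => desColimit_ι_φ F u j)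
      naturality _ _ f := Des.hom_ext fun U =>
        (colimit.w (F ⋙ ℬ.desEval U) f).trans (Category.comp_id _).symm }

lemma desColimit_desc_comm (s : Cocone F) {V U : 𝒰} (u : V ⟶ U) :
    (ℬ.res u).map (colimit.desc (F ⋙ ℬ.desEval U) ((ℬ.desEval U).mapCocone s)) ≫
        (ℬ.desEvalIso u).hom.app s.pt =
      (desColimitφ F u).hom ≫ colimit.desc (F ⋙ ℬ.desEval V) ((ℬ.desEval V).mapCocone s) := by
  refine desColimit_hom_ext F u fun j => ?_
  rw [reassoc_of% desColimit_ι_φ F u j, ← Functor.map_comp_assoc, colimit.ι_desc, colimit.ι_desc]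
  exact (ℬ.desEvalIso u).hom.naturality (s.ι.app j)

/-- The pointwise colimit cocone is a colimit cocone. -/
def desColimitCoconeIsColimit : IsColimit (desColimitCocone F) where
  desc s := Des.homMk (fun U => colimit.desc (F ⋙ ℬ.desEval U) ((ℬ.desEval U).mapCocone s))
    (desColimit_desc_comm F s)
  fac s j := Des.hom_ext fun U => colimit.ι_desc ((ℬ.desEval U).mapCocone s) j
  uniq s _ h := Des.hom_ext fun U => colimit.hom_ext fun j =>
    (congrArg (ℬ.desEval U).map (h j)).trans (colimit.ι_desc ((ℬ.desEval U).mapCocone s) j).symm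

variable (ℬ J)

lemma hasColimitsOfShape_des [∀ U, HasColimitsOfShape J (ℬ.obj U)]
    [∀ {V U : 𝒰} (u : V ⟶ U), PreservesColimitsOfShape J (ℬ.res u)] :
    HasColimitsOfShape J ℬ.Des :=
  ⟨fun F => ⟨⟨_, desColimitCoconeIsColimit F⟩⟩⟩

lemma preservesColimitsOfShape_desEval [∀ U, HasColimitsOfShape J (ℬ.obj U)]
    [∀ {V U : 𝒰} (u : V ⟶ U), PreservesColimitsOfShape J (ℬ.res u)] (U : 𝒰) :
    PreservesColimitsOfShape J (ℬ.desEval U) :=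
  ⟨fun {F} => preservesColimit_of_preserves_colimit_cocone (desColimitCoconeIsColimit F)
    ((colimit.isColimit (F ⋙ ℬ.desEval U)).ofIsoColimit (Cocone.ext (Iso.refl _)
      (fun _ => Category.comp_id _)))⟩

end Colimits

end Prestack

/-! ### Modules over a linear category: limits, colimits, and the tensor–restriction adjunction. -/

namespace LinMod

open Limits

variable {k : Type w} [CommRing k]
variable {a : Type w} [Category.{w} a] [Preadditive a] [Linear k a]
variable {b : Type w} [Category.{w} b] [Preadditive b] [Linear k b]

/-- Limits of functors are pointwise, so linearity can be tested after the projections, where it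
holds by naturality and linearity of the diagram. -/
instance (J : Type*) [Category* J] [HasLimitsOfShape J (ModuleCat.{w} k)] :
    (isLinearModule k a).IsClosedUnderLimitsOfShape J where
  limitsOfShape_le := by
    rintro X ⟨p⟩
    have hom_ext {A A' : a} {s t : X.obj (op A') ⟶ X.obj (op A)}
        (h : ∀ j, s ≫ (p.π.app j).app (op A) = t ≫ (p.π.app j).app (op A)) : s = t :=
      (isLimitOfPreserves ((evaluation _ _).obj (op A)) p.isLimit).hom_ext h
    refine ⟨fun f g => hom_ext fun j => ?_, fun r f => hom_ext fun j => ?_⟩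
    · rw [Preadditive.add_comp, NatTrans.naturality, NatTrans.naturality, NatTrans.naturality,
        (p.prop_diag_obj j).1, Preadditive.comp_add]
    · rw [Linear.smul_comp, NatTrans.naturality, NatTrans.naturality,
        (p.prop_diag_obj j).2, Linear.comp_smul]

instance (J : Type*) [Category* J] [HasColimitsOfShape J (ModuleCat.{w} k)] :
    (isLinearModule k a).IsClosedUnderColimitsOfShape J where
  colimitsOfShape_le := by
    rintro X ⟨p⟩
    have hom_ext {A A' : a} {s t : X.obj (op A') ⟶ X.obj (op A)}
        (h : ∀ j, (p.ι.app j).app (op A') ≫ s = (p.ι.app j).app (op A') ≫ t) : s = t :=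
      (isColimitOfPreserves ((evaluation _ _).obj (op A')) p.isColimit).hom_ext h
    have nat (j : J) {A A' : aᵒᵖ} (f : A ⟶ A') :
        (p.diag.obj j).map f ≫ (p.ι.app j).app A' = (p.ι.app j).app A ≫ X.map f :=
      (p.ι.app j).naturality f
    refine ⟨fun f g => hom_ext fun j => ?_, fun r f => hom_ext fun j => ?_⟩
    · rw [Preadditive.comp_add, ← nat, ← nat, ← nat, (p.prop_diag_obj j).1, Preadditive.add_comp]
    · rw [Linear.comp_smul, ← nat, ← nat, (p.prop_diag_obj j).2, Linear.smul_comp]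

variable (k) in
/-- The functor `F ↦ F(A)`. -/
abbrev valFunctor (A : a) : LinMod k a ⥤ ModuleCat.{w} k :=
  (isLinearModule k a).ι ⋙ (evaluation _ _).obj (op A)

lemma isIso_of_isIso_valFunctor {F F' : LinMod k a} (α : F ⟶ F')
    [∀ A : a, IsIso ((valFunctor k A).map α)] : IsIso α := by
  have : ∀ A, IsIso (((isLinearModule k a).ι.map α).app A) := fun A =>
    inferInstanceAs (IsIso ((valFunctor k A.unop).map α))
  have := NatIso.isIso_of_isIso_app ((isLinearModule k a).ι.map α)
  exact isIso_of_fully_faithful (isLinearModule k a).ι α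

lemma isIso_of_bijective {F F' : LinMod k a} (α : F ⟶ F')
    (h : ∀ A, Function.Bijective (app α A)) : IsIso α := by
  have (A : a) : IsIso ((valFunctor k A).map α) :=
    (ConcreteCategory.isIso_iff_bijective ((valFunctor k A).map α)).2 (h A)
  exact isIso_of_isIso_valFunctor α

/-- Evaluation at `A` preserves monomorphisms. Flatness is thereby turned into injectivity on
elements. -/
lemma injective_of_mono {F F' : LinMod k a} (α : F ⟶ F') [Mono α] (A : a) :
    Function.Injective (app α A) :=
  (ModuleCat.mono_iff_injective ((valFunctor k A).map α)).1 inferInstance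

lemma mono_of_injective {F F' : LinMod k a} (α : F ⟶ F')
    (h : ∀ A, Function.Injective (app α A)) : Mono α :=
  ⟨fun s t hst => hom_ext' fun A x => h A (by rw [← app_comp, hst, app_comp])⟩

/-- Restriction of modules along a `k`-linear functor. -/
def restrict (G : a ⥤ b) [G.Additive] [G.Linear k] : LinMod k b ⥤ LinMod k a :=
  (isLinearModule k a).lift
    ((isLinearModule k b).ι ⋙ (Functor.whiskeringLeft _ _ _).obj G.op)
    (fun N => ⟨fun f g => by simpa using! N.property.1 (G.map f) (G.map g),
      fun r f => by simpa [Functor.map_smul] using! N.property.2 r (G.map f)⟩)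

section

variable {G : a ⥤ b} [G.Additive] [G.Linear k] {F F' : LinMod k a} {N : LinMod k b}

/-- The morphism `x ↦ α (x ⊗ 1)` corresponding to a morphism `α` out of `F ⊗_G b`. -/
def toRestrict (α : tensorObj G F ⟶ N) : F ⟶ (restrict G).obj N :=
  homMk
    (fun A => app α (G.obj A) ∘ₗ (tmLin G F (G.obj A) A).flip (𝟙 (G.obj A)))
    (fun {A A'} f x => by
      have h := app_act α (G.map f) (tm G F x (𝟙 (G.obj A')))
      have h₂ := tm_act G F f x (𝟙 (G.obj A))
      have h₁ := act_tm G F (G.map f) x (𝟙 (G.obj A'))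
      rw [Category.comp_id] at h₁
      rw [Category.id_comp] at h₂
      exact ((congrArg (app α (G.obj A)) (h₂.trans h₁.symm)).trans h))

/-- The component at `A` of a morphism to a restricted module. -/
def restrictApp (β : F ⟶ (restrict G).obj N) (A : a) : F.val A →ₗ[k] N.val (G.obj A) :=
  app β A

lemma restrictApp_act (β : F ⟶ (restrict G).obj N) {A A' : a} (f : A ⟶ A') (x : F.val A') :
    restrictApp β A (F.act f x) = N.act (G.map f) (restrictApp β A' x) :=
  app_act β f x

/-- The morphism `x ⊗ y ↦ β(x) y` corresponding to a morphism `β` to a restricted module. -/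
def ofRestrict (β : F ⟶ (restrict G).obj N) : tensorObj G F ⟶ N :=
  descHom
    (fun B A => LinearMap.mk₂ k (fun x y => N.act y (restrictApp β A x))
      (fun x x' y => by rw [map_add, map_add])
      (fun r x y => by rw [map_smul, map_smul])
      (fun x y y' => act_add N y y' _)
      (fun r x y => act_smul N r y _))
    (fun B A A' f x y => by
      simp only [LinearMap.mk₂_apply]
      rw [act_comp, restrictApp_act])
    (fun _ _ g A x y => act_comp N g y _)

lemma app_ofRestrict_tm (β : F ⟶ (restrict G).obj N) {B : b} {A : a} (x : F.val A)
    (y : B ⟶ G.obj A) :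
    app (ofRestrict β) B (tm G F x y) = N.act y (restrictApp β A x) :=
  app_descHom _ _ _ x y

end

/-- The adjunction between `- ⊗_G b` and restriction along `G`. -/
def tensorRestrictAdj (G : a ⥤ b) [G.Additive] [G.Linear k] :
    tensor (k := k) G ⊣ restrict G :=
  Adjunction.mkOfHomEquiv
    { homEquiv F N :=
        { toFun := toRestrict
          invFun := ofRestrict
          left_inv α := tensorObj_hom_ext fun B A x y => by
            rw [app_ofRestrict_tm]
            refine (app_act α y (tm G F x (𝟙 (G.obj A)))).symm.trans ?_
            refine (congrArg (app α B) (act_tm G F y x (𝟙 (G.obj A)))).trans ?_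
            exact congrArg (fun y => app α B (tm G F x y)) (Category.comp_id y)
          right_inv β := hom_ext' fun A x =>
            (app_ofRestrict_tm β x (𝟙 (G.obj A))).trans (act_id N (G.obj A) _) }
      homEquiv_naturality_left_symm {F F' N} α β := tensorObj_hom_ext fun B A x y => by
        refine (app_ofRestrict_tm _ x y).trans ?_
        refine Eq.trans ?_ (congrArg (app (ofRestrict β) B) (tensorMap_tm G α x y)).symm
        exact (app_ofRestrict_tm _ (app α A x) y).symm
      homEquiv_naturality_right {F N N'} α β := rfl }

/-- Tensor functors therefore commute with all colimits, with no geometricity assumption. -/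
instance (G : a ⥤ b) [G.Additive] [G.Linear k] : (tensor (k := k) G).IsLeftAdjoint :=
  (tensorRestrictAdj G).isLeftAdjoint

end LinMod

/-! ### Abelianness detected by a conservative exact functor. -/

namespace CategoryTheory

open Limits

/-- A preadditive category with a conservative exact additive functor to an abelian category is
abelian. -/
abbrev abelianOfConservativeExact {C D : Type*} [Category* C] [Category* D] [Preadditive C]
    [Abelian D]
    [HasFiniteLimits C] [HasFiniteColimits C] (F : C ⥤ D) [F.Additive]
    [PreservesFiniteLimits F] [PreservesFiniteColimits F] [F.ReflectsIsomorphisms] : Abelian C :=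
  haveI (X Y : C) (f : X ⟶ Y) : IsIso (Abelian.coimageImageComparison f) := by
    -- An exact functor carries the coimage–image comparison of `f` to that of `F.map f`, which is
    -- invertible in the abelian target.
    have e := Abelian.PreservesCoimageImageComparison.iso F f
    have : IsIso (F.map (Abelian.coimageImageComparison f)) :=
      (MorphismProperty.isomorphisms D).arrow_mk_iso_iff e |>.2
        (inferInstanceAs (IsIso (Abelian.coimageImageComparison (F.map f))))
    exact isIso_of_reflects_iso _ F
  Abelian.ofCoimageImageComparisonIsIso

end CategoryTheory

/-! ### Exactness properties of quasi-coherent modules. -/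

namespace Prestack

open Limits

variable {k : Type w} [CommRing k] {𝒰 : Type w} [Category.{w} 𝒰]
variable (𝒜 : Prestack.{w, w, w, w, w} k 𝒰)

/-- The functor `M ↦ M_U` on quasi-coherent modules. -/
def qchEval (U : 𝒰) : 𝒜.Qch ⥤ LinMod k (𝒜.obj U) :=
  𝒜.modPrestack.desEval U

/-- The functor `M ↦ (M_U(A))_{U, A}`. -/
def qchValues : 𝒜.Qch ⥤ (Discrete (Σ U, 𝒜.obj U) ⥤ ModuleCat.{w} k) :=
  (Discrete.functor fun i : Σ U, 𝒜.obj U =>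
    𝒜.qchEval i.1 ⋙ LinMod.valFunctor k i.2).flip

instance : letI := 𝒜.modPrestack.desPreadditive; 𝒜.qchValues.Additive :=
  letI := 𝒜.modPrestack.desPreadditive
  { map_add := rfl }

instance : 𝒜.qchValues.ReflectsIsomorphisms where
  reflects f hf := by
    have (U : 𝒰) : IsIso ((𝒜.modPrestack.desEval U).map f) := by
      have (A : 𝒜.obj U) : IsIso ((LinMod.valFunctor k A).map ((𝒜.modPrestack.desEval U).map f)) :=
        inferInstanceAs (IsIso ((𝒜.qchValues.map f).app ⟨⟨U, A⟩⟩))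
      exact LinMod.isIso_of_isIso_valFunctor _
    exact isIso_of_isIso_desEval _ f

instance (J : Type*) [Category* J] [HasColimitsOfShape J (ModuleCat.{w} k)]
    (U : 𝒰) :
    HasColimitsOfShape J (𝒜.modPrestack.obj U) :=
  inferInstanceAs (HasColimitsOfShape J (LinMod k (𝒜.obj U)))

instance (J : Type*) [Category* J] [HasLimitsOfShape J (ModuleCat.{w} k)] (U : 𝒰) :
    HasLimitsOfShape J (𝒜.modPrestack.obj U) :=
  inferInstanceAs (HasLimitsOfShape J (LinMod k (𝒜.obj U)))

instance {V U : 𝒰} (u : V ⟶ U) : (𝒜.modPrestack.res u).IsLeftAdjoint :=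
  inferInstanceAs (LinMod.tensor (𝒜.res u)).IsLeftAdjoint

/-- Colimits are componentwise because every restriction functor is a left adjoint. -/
instance (J : Type*) [Category* J] [HasColimitsOfShape J (ModuleCat.{w} k)] :
    HasColimitsOfShape J 𝒜.Qch :=
  hasColimitsOfShape_des _ _

instance (J : Type*) [Category* J] [HasColimitsOfShape J (ModuleCat.{w} k)] :
    PreservesColimitsOfShape J 𝒜.qchValues :=
  preservesColimitsOfShape_of_evaluation _ _ fun i =>
    have : PreservesColimitsOfShape J (𝒜.qchEval i.as.1) :=
      preservesColimitsOfShape_desEval 𝒜.modPrestack J i.as.1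
    inferInstanceAs (PreservesColimitsOfShape J (𝒜.qchEval i.as.1 ⋙ LinMod.valFunctor k i.as.2))

variable {𝒜}

lemma IsGeometric.preservesFiniteLimits (h : 𝒜.IsGeometric) {V U : 𝒰} (u : V ⟶ U) :
    PreservesFiniteLimits (𝒜.modPrestack.res u) :=
  (h u).1

/-- Geometricity enters here: left exactness of the tensor functors allows finite limits to be taken
componentwise. -/
lemma IsGeometric.hasFiniteLimits_qch (h : 𝒜.IsGeometric) : HasFiniteLimits 𝒜.Qch where
  out J _ _ := by
    have {V U : 𝒰} (u : V ⟶ U) := h.preservesFiniteLimits u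
    exact hasLimitsOfShape_des _ _

lemma IsGeometric.preservesFiniteLimits_qchValues (h : 𝒜.IsGeometric) :
    PreservesFiniteLimits 𝒜.qchValues where
  preservesFiniteLimits J _ _ :=
    preservesLimitsOfShape_of_evaluation _ _ fun i => by
      have {V U : 𝒰} (u : V ⟶ U) := h.preservesFiniteLimits u
      have : PreservesLimitsOfShape J (𝒜.qchEval i.as.1) :=
        preservesLimitsOfShape_desEval 𝒜.modPrestack J i.as.1
      exact inferInstanceAs
        (PreservesLimitsOfShape J (𝒜.qchEval i.as.1 ⋙ LinMod.valFunctor k i.as.2))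

/-- The abelian structure on `Qch(𝒜)` for a geometric prestack `𝒜`. -/
abbrev IsGeometric.abelianQch (h : 𝒜.IsGeometric) : Abelian 𝒜.Qch :=
  letI := 𝒜.modPrestack.desPreadditive
  haveI := h.hasFiniteLimits_qch
  haveI := h.preservesFiniteLimits_qchValues
  haveI : HasFiniteColimits 𝒜.Qch := ⟨fun _ _ _ => inferInstance⟩
  haveI : PreservesFiniteColimits 𝒜.qchValues := ⟨fun _ _ _ => inferInstance⟩
  abelianOfConservativeExact 𝒜.qchValues

/-- A conservative functor that preserves finite limits also reflects them. Exactness of filtered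
colimits thus descends from families of `k`-modules along `qchValues`. -/
lemma IsGeometric.hasExactColimitsOfShape_qch (h : 𝒜.IsGeometric) (J : Type w) [Category.{w} J]
    [IsFiltered J] : HasExactColimitsOfShape J 𝒜.Qch := by
  have := h.hasFiniteLimits_qch
  have := h.preservesFiniteLimits_qchValues
  have : ReflectsFiniteLimits 𝒜.qchValues :=
    ⟨fun J _ _ => reflectsLimitsOfShape_of_reflectsIsomorphisms⟩
  exact HasExactColimitsOfShape.domain_of_functor J 𝒜.qchValues

end Prestack

/-! ### Submodules, spanning sets of tensor products, and modules presented on fixed sets. -/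

namespace LinMod

variable {k : Type w} [CommRing k]
variable {a : Type w} [Category.{w} a] [Preadditive a] [Linear k a]
variable {b : Type w} [Category.{w} b] [Preadditive b] [Linear k b]

section Sub

variable (F : LinMod k a) (S : ∀ A, Submodule k (F.val A))
  (hS : ∀ {A A' : a} (f : A ⟶ A') (x : F.val A'), x ∈ S A' → F.act f x ∈ S A)

/-- The submodule of `F` with values `S A`. -/
def sub : LinMod k a :=
  LinMod.mk (fun A => S A) (fun f => (F.act f).restrict (hS f))
    (fun A x => Subtype.ext (F.act_id A x.1))
    (fun f g x => Subtype.ext (F.act_comp f g x.1))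
    (fun f g x => Subtype.ext (F.act_add f g x.1))
    (fun r f x => Subtype.ext (F.act_smul r f x.1))

/-- The inclusion of a submodule. -/
def subι : sub F S hS ⟶ F :=
  homMk (fun A => (S A).subtype) (fun _ _ => rfl)

lemma app_subι_mem (A : a) (x : (sub F S hS).val A) : app (subι F S hS) A x ∈ S A :=
  Subtype.property (p := (· ∈ S A)) x

lemma app_subι_injective (A : a) : Function.Injective (app (subι F S hS) A) :=
  Subtype.val_injective (p := (· ∈ S A))

instance : Mono (subι F S hS) :=
  mono_of_injective _ (app_subι_injective F S hS)

variable {F S} in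
/-- An element of a submodule. -/
def subMk {A : a} (x : F.val A) (hx : x ∈ S A) : (sub F S hS).val A :=
  (⟨x, hx⟩ : S A)

variable {F S} in
/-- A morphism with image in a submodule factors through it. -/
def subLift {P : LinMod k a} (α : P ⟶ F) (hα : ∀ A x, app α A x ∈ S A) : P ⟶ sub F S hS :=
  homMk (fun A => (app α A).codRestrict (S A) (hα A))
    (fun f x => Subtype.ext (app_act α f x))

end Sub

section Tensor

variable (G : a ⥤ b) (F : LinMod k a)

/-- The quotient map by this span kills every elementary tensor, hence vanishes by the universal
property. -/
lemma span_tm_eq_top (B : b) :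
    Submodule.span k {m : (tensorObj G F).val B | ∃ A x y, m = tm G F (A := A) x y} = ⊤ := by
  rw [← Submodule.ker_mkQ (Submodule.span k _), LinearMap.ker_eq_top]
  refine tensorObj_ext fun A x y => ?_
  rw [LinearMap.zero_apply, Submodule.mkQ_apply, Submodule.Quotient.mk_eq_zero]
  exact Submodule.subset_span ⟨A, x, y, rfl⟩

/-- An element is a finite combination of tensors, so finitely many left factors suffice. Listing
them as a sequence over every `A`, with `y` left free, gives an indexing independent of `m`, as
needed for formal terms. -/
lemma exists_mem_span_tm {B : b} (m : (tensorObj G F).val B) :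
    ∃ g : ∀ A, ℕ → F.val A,
      m ∈ Submodule.span k {m' : (tensorObj G F).val B | ∃ A i y, m' = tm G F (g A i) y} := by
  classical
  have hm : m ∈ Submodule.span k
      {m : (tensorObj G F).val B | ∃ A x y, m = tm G F (A := A) x y} := by
    rw [span_tm_eq_top]; trivial
  induction hm using Submodule.span_induction with
  | mem m h =>
    obtain ⟨A, x, y, rfl⟩ := h
    refine ⟨Function.update (fun _ _ => 0) A (fun _ => x), Submodule.subset_span ⟨A, 0, y, ?_⟩⟩
    rw [Function.update_self]
  | zero => exact ⟨fun _ _ => 0, Submodule.zero_mem _⟩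
  | add m m' _ _ h h' =>
    obtain ⟨g, hg⟩ := h
    obtain ⟨g', hg'⟩ := h'
    -- The two sequences are merged into one through the bijection between ℕ ⊕ ℕ and ℕ.
    refine ⟨fun A i => Sum.elim (g A) (g' A) (Equiv.natSumNatEquivNat.symm i),
      Submodule.add_mem _ (Submodule.span_mono ?_ hg) (Submodule.span_mono ?_ hg')⟩
    · rintro _ ⟨A, i, y, rfl⟩
      exact ⟨A, Equiv.natSumNatEquivNat (Sum.inl i), y, by
        beta_reduce; rw [Equiv.symm_apply_apply]; rfl⟩
    · rintro _ ⟨A, i, y, rfl⟩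
      exact ⟨A, Equiv.natSumNatEquivNat (Sum.inr i), y, by
        beta_reduce; rw [Equiv.symm_apply_apply]; rfl⟩
  | smul r m _ h =>
    obtain ⟨g, hg⟩ := h
    exact ⟨g, Submodule.smul_mem _ r hg⟩

end Tensor

section Generated

variable (k) (T : a → Type w)

/-- The modules over `a` whose values are given quotients of the free modules on the types
`T A`. -/
def QuotientData : Type w :=
  Σ p : ∀ A, Submodule k (T A →₀ k),
    { act : ∀ {A A' : a} (_ : A ⟶ A'), ((T A' →₀ k) ⧸ p A') →ₗ[k] (T A →₀ k) ⧸ p A //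
      (∀ A x, act (𝟙 A) x = x) ∧
      (∀ {A A' A'' : a} (f : A ⟶ A') (g : A' ⟶ A'') (x : (T A'' →₀ k) ⧸ p A''),
        act (f ≫ g) x = act f (act g x)) ∧
      (∀ {A A' : a} (f g : A ⟶ A') (x : (T A' →₀ k) ⧸ p A'),
        act (f + g) x = act f x + act g x) ∧
      (∀ {A A' : a} (r : k) (f : A ⟶ A') (x : (T A' →₀ k) ⧸ p A'),
        act (r • f) x = r • act f x) }

variable {k T}

/-- The module given by a `QuotientData`. -/
def QuotientData.toLinMod (D : QuotientData k T) : LinMod k a :=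
  LinMod.mk (fun A => (T A →₀ k) ⧸ D.1 A) D.2.1 D.2.2.1 D.2.2.2.1 D.2.2.2.2.1 D.2.2.2.2.2

/-- This is the smallness bound: each value is the free module on `T A` modulo the relations among
the generators, and the action is transported to these quotients. -/
lemma exists_iso_quotientData (F : LinMod k a) (e : ∀ A, T A → F.val A)
    (he : ∀ A, Submodule.span k (Set.range (e A)) = ⊤) :
    ∃ D : QuotientData k T, Nonempty (F ≅ D.toLinMod) := by
  have E (A : a) := (Finsupp.linearCombination k (e A)).quotKerEquivOfSurjective
    (by rw [← LinearMap.range_eq_top, Finsupp.range_linearCombination, he])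
  let D : QuotientData k T :=
    ⟨fun A => LinearMap.ker (Finsupp.linearCombination k (e A)),
      fun {A A'} f => (E A).symm.toLinearMap ∘ₗ F.act f ∘ₗ (E A').toLinearMap,
      fun A x => by simp [act_id], fun f g x => by simp [act_comp],
      fun f g x => by simp [act_add], fun r f x => by simp [act_smul]⟩
  refine ⟨D, ?_⟩
  let α : F ⟶ D.toLinMod := homMk (fun A => (E A).symm.toLinearMap) (fun {A A'} f x =>
    congrArg (fun y => (E A).symm (F.act f y)) ((E A').apply_symm_apply x).symm)
  have : IsIso α := isIso_of_bijective α fun A => (E A).symm.bijective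
  exact ⟨asIso α⟩

end Generated

end LinMod

/-! ### Transport of descent data along isomorphisms of components. -/

namespace Prestack

section Transport

variable {k : Type w} [CommRing k] {𝒰 : Type u} [Category.{v} 𝒰]
variable {ℬ : Prestack.{w, v, u, v', u'} k 𝒰}

/-- Descent data on a prescribed family of objects. -/
def DesData (X : ∀ U, ℬ.obj U) : Type (max u v v') :=
  { φ : ∀ {V U : 𝒰} (u : V ⟶ U), (ℬ.res u).obj (X U) ≅ X V //
    ∀ {W V U : 𝒰} (u : V ⟶ U) (v : W ⟶ V),
      (ℬ.res v).map (φ u).hom ≫ (φ v).hom = (ℬ.c u v).hom.app (X U) ≫ (φ (v ≫ u)).hom }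

/-- The descent datum given by a `DesData`. -/
def DesData.toDes {X : ∀ U, ℬ.obj U} (D : DesData X) : ℬ.Des :=
  Des.mk X D.1 D.2

/-- Transport of a descent datum along isomorphisms. -/
def Des.transport (B : ℬ.Des) (X : ∀ U, ℬ.obj U) (e : ∀ U, (ℬ.desEval U).obj B ≅ X U) :
    DesData X :=
  ⟨fun {V U} u => (ℬ.res u).mapIso (e U).symm ≪≫ (ℬ.desEvalIso u).app B ≪≫ e V,
    fun {W V U} u v => by
      have h := ℬ.desEvalIso_comp u v B
      have h' := (ℬ.c u v).hom.naturality (e U).inv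
      simp only [Functor.comp_map] at h'
      simp only [Iso.trans_hom, Functor.mapIso_hom, Iso.symm_hom, Iso.app_hom, Functor.map_comp,
        Category.assoc, Iso.map_hom_inv_id_assoc]
      rw [reassoc_of% h, reassoc_of% h']⟩

/-- The canonical isomorphism from a descent datum to its transport. -/
def Des.transportHom (B : ℬ.Des) (X : ∀ U, ℬ.obj U) (e : ∀ U, (ℬ.desEval U).obj B ≅ X U) :
    B ⟶ (B.transport X e).toDes :=
  Des.homMk (fun U => (e U).hom) (fun {_ U} u => Iso.map_hom_inv_id_assoc (e U) (ℬ.res u) _)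

lemma Des.isIso_transportHom (B : ℬ.Des) (X : ∀ U, ℬ.obj U)
    (e : ∀ U, (ℬ.desEval U).obj B ≅ X U) : IsIso (B.transportHom X e) := by
  have (U : 𝒰) : IsIso ((ℬ.desEval U).map (B.transportHom X e)) := (e U).isIso_hom
  exact isIso_of_isIso_desEval _ _

/-- Once the components range over a set, so do the descent data up to isomorphism. -/
lemma Des.exists_iso_toDes (B : ℬ.Des) (X : ∀ U, ℬ.obj U)
    (e : ∀ U, (ℬ.desEval U).obj B ≅ X U) : ∃ D : DesData X, Nonempty (B ≅ D.toDes) :=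
  haveI := B.isIso_transportHom X e
  ⟨B.transport X e, ⟨asIso (B.transportHom X e)⟩⟩

end Transport

/-! ### The quasi-coherent submodule generated by an element. -/

open LinMod

variable {k : Type w} [CommRing k] {𝒰 : Type w} [Category.{w} 𝒰]
variable {𝒜 : Prestack.{w, w, w, w, w} k 𝒰}

section Structure

variable (M : 𝒜.Qch)

/-- The structure isomorphism `M_U ⊗_u 𝒜(V) ≅ M_V`. -/
def qchIso {V U : 𝒰} (u : V ⟶ U) :
    tensorObj (𝒜.res u) ((𝒜.qchEval U).obj M) ≅ (𝒜.qchEval V).obj M :=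
  (𝒜.modPrestack.desEvalIso u).app M

lemma qchIso_comp {W V U : 𝒰} (u : V ⟶ U) (v : W ⟶ V) :
    tensorMap (𝒜.res v) (qchIso M u).hom ≫ (qchIso M v).hom =
      tensorCompHom (𝒜.c u v).hom ((𝒜.qchEval U).obj M) ≫ (qchIso M (v ≫ u)).hom :=
  𝒜.modPrestack.desEvalIso_comp u v M

lemma app_qchIso_bijective {V U : 𝒰} (u : V ⟶ U) (B : 𝒜.obj V) :
    Function.Bijective (app (qchIso M u).hom B) :=
  Function.bijective_iff_has_inverse.2 ⟨app (qchIso M u).inv B,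
    fun x => by rw [← app_comp, Iso.hom_inv_id, app_id],
    fun x => by rw [← app_comp, Iso.inv_hom_id, app_id]⟩

lemma exists_mem_span_qchIso {V U : 𝒰} (u : V ⟶ U) {B : 𝒜.obj V}
    (m : ((𝒜.qchEval V).obj M).val B) :
    ∃ g : ∀ A, ℕ → ((𝒜.qchEval U).obj M).val A,
      m ∈ Submodule.span k {m' | ∃ A i y, m' = app (qchIso M u).hom B (tm _ _ (g A i) y)} := by
  obtain ⟨m, rfl⟩ := (app_qchIso_bijective M u B).2 m
  obtain ⟨g, hg⟩ := exists_mem_span_tm _ _ m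
  refine ⟨g, Submodule.span_mono ?_
    (Submodule.apply_mem_span_image_of_mem_span (app (qchIso M u).hom B) hg)⟩
  rintro _ ⟨_, ⟨A, i, y, rfl⟩, rfl⟩
  exact ⟨A, i, y, rfl⟩

/-- Elements `g A i ∈ M_U(A)` such that a given `m ∈ M_V(B)` is a linear combination of elements
`φ_u(g A i ⊗ y)`. -/
def parts {V U : 𝒰} (u : V ⟶ U) {B : 𝒜.obj V} (m : ((𝒜.qchEval V).obj M).val B) :
    ∀ A, ℕ → ((𝒜.qchEval U).obj M).val A :=
  (exists_mem_span_qchIso M u m).choose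

lemma mem_span_parts {V U : 𝒰} (u : V ⟶ U) {B : 𝒜.obj V} (m : ((𝒜.qchEval V).obj M).val B) :
    m ∈ Submodule.span k
      {m' | ∃ A i y, m' = app (qchIso M u).hom B (tm _ _ (parts M u m A i) y)} :=
  (exists_mem_span_qchIso M u m).choose_spec

end Structure

variable (𝒜) in
/-- Formal expressions for the elements of the quasi-coherent submodule generated by an element of
`M_{U₀}(A₀)`, for a quasi-coherent module `M`. -/
inductive Term {U₀ : 𝒰} (A₀ : 𝒜.obj U₀) : ∀ U, 𝒜.obj U → Type w
  | base : Term A₀ U₀ A₀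
  | act {U : 𝒰} {A A' : 𝒜.obj U} (f : A ⟶ A') (t : Term A₀ U A') : Term A₀ U A
  | glue {V U : 𝒰} (u : V ⟶ U) {A : 𝒜.obj U} {B : 𝒜.obj V} (y : B ⟶ (𝒜.res u).obj A)
      (t : Term A₀ U A) : Term A₀ V B
  -- Names the `i`-th chosen element over `A` for the value of `t`; this closure is what makes the
  -- structure maps surjective.
  | part {V U : 𝒰} (u : V ⟶ U) {B : 𝒜.obj V} (A : 𝒜.obj U) (i : ℕ) (t : Term A₀ V B) :
      Term A₀ U A

namespace Term

variable (M : 𝒜.Qch) {U₀ : 𝒰} {A₀ : 𝒜.obj U₀} (x : ((𝒜.qchEval U₀).obj M).val A₀)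

/-- The value of a formal expression in `M`. -/
def eval : ∀ {U} {A : 𝒜.obj U}, Term 𝒜 A₀ U A → ((𝒜.qchEval U).obj M).val A
  | _, _, base => x
  | _, _, act f t => LinMod.act _ f (eval t)
  | _, _, glue u y t => app (qchIso M u).hom _ (tm _ _ (eval t) y)
  | _, _, part u A i t => parts M u (eval t) A i

/-- The values of the quasi-coherent submodule generated by `x`. -/
def values {U : 𝒰} (A : 𝒜.obj U) : Submodule k (((𝒜.qchEval U).obj M).val A) :=
  Submodule.span k (Set.range fun t : Term 𝒜 A₀ U A => eval M x t)

lemma eval_mem_values {U : 𝒰} {A : 𝒜.obj U} (t : Term 𝒜 A₀ U A) : eval M x t ∈ values M x A :=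
  Submodule.subset_span ⟨t, rfl⟩

lemma act_mem_values {U : 𝒰} {A A' : 𝒜.obj U} (f : A ⟶ A') (m : ((𝒜.qchEval U).obj M).val A')
    (hm : m ∈ values M x A') : LinMod.act _ f m ∈ values M x A := by
  induction hm using Submodule.span_induction with
  | mem m h => obtain ⟨t, rfl⟩ := h; exact eval_mem_values M x (act f t)
  | zero => rw [map_zero]; exact Submodule.zero_mem _
  | add m m' _ _ h h' => rw [map_add]; exact Submodule.add_mem _ h h'
  | smul r m _ h => rw [map_smul]; exact Submodule.smul_mem _ r h

/-- The component at `U` of the quasi-coherent submodule generated by `x`. -/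
def genObj (U : 𝒰) : LinMod k (𝒜.obj U) :=
  sub ((𝒜.qchEval U).obj M) (values M x) (act_mem_values M x)

/-- The inclusion of the quasi-coherent submodule generated by `x`. -/
def genι (U : 𝒰) : genObj M x U ⟶ (𝒜.qchEval U).obj M :=
  subι _ _ _

instance (U : 𝒰) : Mono (genι M x U) :=
  inferInstanceAs (Mono (subι _ _ _))

lemma app_qchIso_tm_mem_values {V U : 𝒰} (u : V ⟶ U) {A : 𝒜.obj U} {B : 𝒜.obj V}
    (m : ((𝒜.qchEval U).obj M).val A) (hm : m ∈ values M x A) (y : B ⟶ (𝒜.res u).obj A) :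
    app (qchIso M u).hom B (tm _ _ m y) ∈ values M x B := by
  -- The tensor is written as a bilinear map, so that additivity and homogeneity in `m` are
  -- available in the span induction.
  simp only [← tmLin_apply]
  induction hm using Submodule.span_induction with
  | mem m h => obtain ⟨t, rfl⟩ := h; exact eval_mem_values M x (glue u y t)
  | zero => rw [map_zero, LinearMap.zero_apply, map_zero]; exact Submodule.zero_mem _
  | add m m' _ _ h h' =>
    rw [map_add, LinearMap.add_apply, map_add]; exact Submodule.add_mem _ h h'
  | smul r m _ h => rw [map_smul, LinearMap.smul_apply, map_smul]; exact Submodule.smul_mem _ r h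

/-- The composite `N_U ⊗_u 𝒜(V) ⟶ M_U ⊗_u 𝒜(V) ≅ M_V` for the submodule `N` generated by `x`. -/
def genAux {V U : 𝒰} (u : V ⟶ U) :
    tensorObj (𝒜.res u) (genObj M x U) ⟶ (𝒜.qchEval V).obj M :=
  tensorMap (𝒜.res u) (genι M x U) ≫ (qchIso M u).hom

lemma app_genAux_tm {V U : 𝒰} (u : V ⟶ U) {A : 𝒜.obj U} {B : 𝒜.obj V}
    (m : (genObj M x U).val A) (y : B ⟶ (𝒜.res u).obj A) :
    app (genAux M x u) B (tm _ _ m y) =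
      app (qchIso M u).hom B (tm _ _ (app (genι M x U) A m) y) := by
  rw [genAux, app_comp, tensorMap_tm]

/-- Closure under `glue` keeps the image inside the generated submodule. Closure under `part` makes
the image exhaust it, since each term value is a combination of glued parts. -/
lemma range_app_genAux {V U : 𝒰} (u : V ⟶ U) (B : 𝒜.obj V) :
    LinearMap.range (app (genAux M x u) B) = values M x B := by
  apply le_antisymm
  · rw [LinearMap.range_eq_map, ← span_tm_eq_top, Submodule.map_span_le]
    rintro _ ⟨A, m, y, rfl⟩
    rw [app_genAux_tm]
    exact app_qchIso_tm_mem_values M x u _ (app_subι_mem _ _ _ A m) y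
  · refine Submodule.span_le.2 ?_
    rintro _ ⟨t, rfl⟩
    refine Submodule.span_le.2 ?_ (mem_span_parts M u (eval M x t))
    rintro _ ⟨A, i, y, rfl⟩
    exact ⟨tm _ _ (subMk (act_mem_values M x) _ (eval_mem_values M x (part u A i t))) y,
      app_genAux_tm M x u _ y⟩

/-- The structure morphisms of the quasi-coherent submodule generated by `x`. -/
def genφ {V U : 𝒰} (u : V ⟶ U) : tensorObj (𝒜.res u) (genObj M x U) ⟶ genObj M x V :=
  subLift _ (genAux M x u) (fun B m => range_app_genAux M x u B ▸ ⟨m, rfl⟩)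

lemma genφ_ι {V U : 𝒰} (u : V ⟶ U) :
    genφ M x u ≫ genι M x V = tensorMap (𝒜.res u) (genι M x U) ≫ (qchIso M u).hom :=
  rfl

/-- Injectivity is flatness: tensoring keeps the inclusion into M_U injective, and the structure map
of `M` is bijective. Surjectivity is `range_app_genAux`. -/
lemma isIso_genφ (h : 𝒜.IsGeometric) {V U : 𝒰} (u : V ⟶ U) : IsIso (genφ M x u) := by
  have : Limits.PreservesFiniteLimits (tensor (k := k) (𝒜.res u)) := (h u).1
  have hm : Mono (tensorMap (𝒜.res u) (genι M x U)) :=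
    inferInstanceAs (Mono ((tensor (𝒜.res u)).map (genι M x U)))
  refine isIso_of_bijective _ fun B => ⟨?_, fun m => ?_⟩
  · have h₁ : Function.Injective (app (genAux M x u) B) :=
      (app_qchIso_bijective M u B).1.comp
        (injective_of_mono (tensorMap (𝒜.res u) (genι M x U)) B)
    exact Function.Injective.of_comp (f := app (genι M x V) B) h₁
  · have hm : app (genι M x V) B m ∈ LinearMap.range (app (genAux M x u) B) := by
      rw [range_app_genAux]
      exact app_subι_mem _ _ _ B m
    obtain ⟨n, hn⟩ := hm
    exact ⟨n, app_subι_injective _ _ _ B hn⟩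

/-- The cocycle identity may be checked after the monomorphism into `M`, where it follows from that
of `M` and naturality of the twist. -/
lemma genφ_comp {W V U : 𝒰} (u : V ⟶ U) (v : W ⟶ V) :
    tensorMap (𝒜.res v) (genφ M x u) ≫ genφ M x v =
      tensorCompHom (𝒜.c u v).hom (genObj M x U) ≫ genφ M x (v ≫ u) := by
  have h₁ := congrArg (tensor (𝒜.res v)).map (genφ_ι M x u)
  have h₂ := (tensorComp (k := k) (𝒜.c u v)).hom.naturality (genι M x U)
  rw [Functor.map_comp, Functor.map_comp] at h₁
  rw [← cancel_mono (genι M x W), Category.assoc, Category.assoc, genφ_ι, genφ_ι]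
  refine ((reassoc_of% h₁) _).trans ?_
  refine (congrArg (_ ≫ ·) (qchIso_comp M u v)).trans ?_
  exact (reassoc_of% h₂) _

/-- The quasi-coherent submodule generated by `x`. -/
def gen (h : 𝒜.IsGeometric) : 𝒜.Qch :=
  Des.mk (ℬ := 𝒜.modPrestack) (genObj M x)
    (fun u => @asIso _ _ _ _ (genφ M x u) (isIso_genφ M x h u)) (genφ_comp M x)

/-- The inclusion of the quasi-coherent submodule generated by `x`. -/
def genHom (h : 𝒜.IsGeometric) : gen M x h ⟶ M :=
  Des.homMk (ℬ := 𝒜.modPrestack) (genι M x) (fun u => (genφ_ι M x u).symm)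

/-- The values of terms span the generated submodule, and the set of terms depends only on `A₀`, not
on `M` or `x`. -/
lemma exists_iso_genObj (U : 𝒰) :
    ∃ D : QuotientData k (fun A : 𝒜.obj U => Term 𝒜 A₀ U A),
      Nonempty (genObj M x U ≅ D.toLinMod) := by
  refine exists_iso_quotientData _
    (fun A t => subMk (act_mem_values M x) _ (eval_mem_values M x t)) (fun A => ?_)
  refine eq_top_iff.2 ((Submodule.span_span_coe_preimage (R := k)
    (s := Set.range fun t : Term 𝒜 A₀ U A => eval M x t)).ge.trans (Submodule.span_mono ?_))
  rintro ⟨_, _⟩ ⟨t, rfl⟩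
  exact ⟨t, rfl⟩

end Term

/-! ### A set of generators. -/

variable (𝒜) in
/-- An index set for a family of generators of `Qch(𝒜)`. -/
def GenIndex : Type w :=
  Σ (U₀ : 𝒰) (A₀ : 𝒜.obj U₀) (D : ∀ U, QuotientData k (fun A : 𝒜.obj U => Term 𝒜 A₀ U A)),
    DesData (ℬ := 𝒜.modPrestack) (fun U => (D U).toLinMod)

/-- The quasi-coherent module with a given index. -/
def GenIndex.toQch (i : GenIndex 𝒜) : 𝒜.Qch :=
  i.2.2.2.toDes

/-- The submodule generated by `x` contains `x` as the value of `Term.base`, and it is isomorphic to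
a member of the indexed family. -/
lemma exists_genIndex_hom (h : 𝒜.IsGeometric) (M : 𝒜.Qch) {U₀ : 𝒰} {A₀ : 𝒜.obj U₀}
    (x : ((𝒜.qchEval U₀).obj M).val A₀) :
    ∃ (i : GenIndex 𝒜) (s : i.toQch ⟶ M) (y : ((𝒜.qchEval U₀).obj i.toQch).val A₀),
      app ((𝒜.qchEval U₀).map s) A₀ y = x := by
  choose D hD using Term.exists_iso_genObj M x
  obtain ⟨e, ⟨α⟩⟩ := Des.exists_iso_toDes (ℬ := 𝒜.modPrestack) (Term.gen M x h)
    (fun U => (D U).toLinMod) (fun U => (hD U).some)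
  refine ⟨⟨U₀, A₀, D, e⟩, α.inv ≫ Term.genHom M x h,
    app ((𝒜.qchEval U₀).map α.hom) A₀
      (subMk (Term.act_mem_values M x) x (Term.eval_mem_values M x Term.base)), ?_⟩
  refine (app_comp _ _ A₀ _).symm.trans ?_
  have h₁ : (𝒜.qchEval U₀).map α.hom ≫ (𝒜.qchEval U₀).map (α.inv ≫ Term.genHom M x h) =
      Term.genι M x U₀ := by
    rw [← Functor.map_comp, Iso.hom_inv_id_assoc]
    rfl
  exact congrArg (fun β => app β A₀ _) h₁

lemma IsGeometric.hasSeparator_qch (h : 𝒜.IsGeometric) : HasSeparator 𝒜.Qch := by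
  let := 𝒜.modPrestack.desPreadditive
  -- The separator is the coproduct of the family. Morphisms that agree on all maps from its members
  -- agree on every element, since each element comes from such a map.
  refine ⟨_, (isSeparator_sigma (GenIndex.toQch (𝒜 := 𝒜))).2 fun M M' f g hfg => ?_⟩
  refine Des.hom_ext fun U => hom_ext' fun A x => ?_
  obtain ⟨i, s, y, rfl⟩ := exists_genIndex_hom h M x
  have hs := congrArg (fun t => app ((𝒜.qchEval U).map t) A y) (hfg _ ⟨i⟩ s)
  exact hs

end Prestack

end

/-- The category of quasi-coherent modules over a geometric prestack of small `k`-linear categories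
on a small category is a Grothendieck abelian category (for its additive structure given by
componentwise addition of morphisms). -/
theorem mainTheorem6 {k : Type w} [CommRing k] {𝒰 : Type w} [Category.{w} 𝒰]
    (𝒜 : Prestack.{w, w, w, w, w} k 𝒰) (h𝒜 : 𝒜.IsGeometric) :
    ∃ h : Abelian 𝒜.Qch,
      h.toPreadditive = 𝒜.modPrestack.desPreadditive ∧
        IsGrothendieckAbelian.{w} 𝒜.Qch := by
  -- The abelian structure is built on top of the componentwise addition, so the two additive
  -- structures agree definitionally.
  refine ⟨h𝒜.abelianQch, rfl, ?_⟩
  let := h𝒜.abelianQch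
  have := h𝒜.hasExactColimitsOfShape_qch
  have : Limits.HasFilteredColimitsOfSize.{w, w} 𝒜.Qch := ⟨fun _ _ _ => inferInstance⟩
  exact { ab5OfSize := ⟨fun _ _ _ => inferInstance⟩
          hasSeparator := h𝒜.hasSeparator_qch }
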